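/- Let $G$ be a finite simple graph on the nodes $\{1,\dots,N\}$ (the observed pairs of sensors) and let $\mathcal S\subseteq\{1,\dots,N\}$. At each time $t=1,2,\dots$ one real similarity $y_{et}$ is observed on every edge $e=\{i,j\}$ of $G$. Let $\mathbb P_0,\mathbb P_1,\mathbb P_2$ be probability measures on $\mathbb R$. Under $\mathbb P^\infty$ all $y_{et}$ are i.i.d. with law $\mathbb P_0$. Under $\mathbb P_\kappa$ ($\kappa\ge 1$) all $y_{et}$ are independent; they have law $\mathbb P_0$ for $t<\kappa$, and for $t\ge\kappa$ they have law $\mathbb P_1$ if $e$ joins $\mathcal S$ to its complement, $\mathbb P_2$ if both endpoints of $e$ lie in $\mathcal S$, and $\mathbb P_0$ otherwise. Let $\mathsf{cut}(\mathcal S)$ be the number of edges of $G$ that join $\mathcal S$ to its complement. For a stopping time $T$ of the observations let $\mathbb E^\infty[T]$ be its average run length and $$\mathbb E^1[T]=\sup_{\kappa\ge 1}\operatorname{ess\,sup}\mathbb E_\kappa\big[(T-\kappa+1)^+\,\big|\,y_{es},\ s\le\kappa-1,\ e\in E(G)\big]$$ its worst-case expected detection delay. Assume $\mathsf{cut}(\mathcal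 S)>0$, $\mathbb P_1\ne\mathbb P_0$ and $\mathsf{KL}(\mathbb P_1\|\mathbb P_0)<\infty$. Then the best worst-case expected detection delay subject to the constraint $\mathbb E^\infty[T]\ge\gamma$ is, as $\gamma\to\infty$, $\log\gamma/(\mathsf{cut}(\mathcal S)\,\mathsf{KL}(\mathbb P_1\|\mathbb P_0))+O(1)$, in the following sense. 1. (Upper bound.) If $\log\frac{d\mathbb P_1}{d\mathbb P_0}$ is square-integrable under $\mathbb P_1$, then there is a constant $C$ such that for every $\gamma\ge 1$ there is a stopping time $T$, not using the edges inside $\mathcal S$, with $\mathbb E^\infty[T]\ge\gamma$ and $$\mathbb E^1[T]\le\frac{\log\gamma}{\mathsf{cut}(\mathcal S)\,\mathsf{KL}(\mathbb P_1\|\mathbb P_0)}+C.$$ 2. (Lower bound.) There is a constant $C$ such that for every $\gamma\ge 1$ and every stopping time $T$ with $\mathbb E^\infty[T]\ge\gamma$ which does not use the edges inside $\mathcal S$ (or which is arbitrary, if $\mathbb P_2=\mathbb P_0$), $$\mathbb E^1[T]\ge\frac{\log\gamma}{\mathsf{cut}(\mathcal S)\,\mathsf{KL}(\mathbb P_1\|\mathbb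 P_0)}-C.$$ The constants $C$ do not depend on $\gamma$ or $T$. -/

import Mathlib

open MeasureTheory ProbabilityTheory InformationTheory
open scoped ENNReal

namespace SimNet

/-- The edges of `G` cut by separating `S` from its complement. -/
def cutEdges {N : ℕ} (G : SimpleGraph (Fin N)) (S : Finset (Fin N)) : Set (Sym2 (Fin N)) :=
  {e ∈ G.edgeSet | ∃ i ∈ S, ∃ j ∉ S, e = s(i, j)}

/-- The edges of `G` both of whose endpoints lie in `S`. -/
def insideEdges {N : ℕ} (G : SimpleGraph (Fin N)) (S : Finset (Fin N)) : Set (Sym2 (Fin N)) :=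
  {e ∈ G.edgeSet | ∀ i ∈ e, i ∈ S}

/-- `cut(S)`: the number of edges cut by separating `S` from its complement. -/
noncomputable def cut {N : ℕ} (G : SimpleGraph (Fin N)) (S : Finset (Fin N)) : ℕ :=
  (cutEdges G S).ncard

/-- A realization of the sequence of similarity networks: `ω k e` is the similarity observed on
the edge `e` at time `k + 1`, so that time runs through `1, 2, 3, …`. -/
abbrev Obs {N : ℕ} (G : SimpleGraph (Fin N)) : Type := ℕ → G.edgeSet → ℝ

open Classical in
/-- The law of a single post-change similarity: `P₁` on the edges between `S` and its complement,
`P₂` on the edges inside `S`, and `P₀` on all the other edges. -/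
noncomputable def postLaw {N : ℕ} (G : SimpleGraph (Fin N)) (S : Finset (Fin N))
    (P₀ P₁ P₂ : Measure ℝ) (e : G.edgeSet) : Measure ℝ :=
  if (e : Sym2 (Fin N)) ∈ cutEdges G S then P₁
  else if (e : Sym2 (Fin N)) ∈ insideEdges G S then P₂
  else P₀

/-- The law `ℙ^∞` of the observations when there is no change: all similarities are i.i.d. with
law `P₀`, over the edges and over time. -/
noncomputable def nullLaw {N : ℕ} (G : SimpleGraph (Fin N)) (P₀ : Measure ℝ) :
    Measure (Obs G) :=
  Measure.infinitePi fun _ : ℕ => Measure.infinitePi fun _ : G.edgeSet => P₀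

/-- The law `ℙ_κ` of the observations when time `κ` is the first post-change time: all the
similarities are independent, with law `P₀` at the times `t < κ` and with the post-change law
of their edge at the times `t ≥ κ`. -/
noncomputable def changeLaw {N : ℕ} (G : SimpleGraph (Fin N)) (S : Finset (Fin N))
    (P₀ P₁ P₂ : Measure ℝ) (κ : ℕ) : Measure (Obs G) :=
  Measure.infinitePi fun k : ℕ => Measure.infinitePi fun e : G.edgeSet =>
    if k + 1 < κ then P₀ else postLaw G S P₀ P₁ P₂ e

/-- The information available at time `t` to an observer who sees the edges in `U` only: the
σ-algebra generated by the similarities on the edges in `U` at the times `1, …, t`. -/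
def obsFiltration {N : ℕ} (G : SimpleGraph (Fin N)) (U : Set (Sym2 (Fin N))) :
    Filtration ℕ (inferInstance : MeasurableSpace (Obs G)) where
  seq t := ⨆ (k : ℕ) (_ : k < t) (e : G.edgeSet) (_ : (e : Sym2 (Fin N)) ∈ U),
    MeasurableSpace.comap (fun ω : Obs G => ω k e) inferInstance
  mono' _ _ hst := iSup_mono fun _ => iSup_mono' fun hk => ⟨lt_of_lt_of_le hk hst, le_rfl⟩
  le' _ := iSup_le fun k => iSup_le fun _ => iSup_le fun e => iSup_le fun _ =>
    Measurable.comap_le ((measurable_pi_apply e).comp (measurable_pi_apply k))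

/-- The average run length `E^∞[T]`. -/
noncomputable def ARL {N : ℕ} (G : SimpleGraph (Fin N)) (P₀ : Measure ℝ)
    (T : Obs G → WithTop ℕ) : ℝ≥0∞ :=
  ∫⁻ ω, ENat.toENNReal (T ω) ∂(nullLaw G P₀)

/-- The worst-case expected detection delay
`E^1[T] = sup_{κ ≥ 1} ess sup E_κ[(T - κ + 1)^+ | observations at the times 1, …, κ - 1]`.
Subtraction in `ℝ≥0∞` is truncated at `0`, hence it is the positive part. -/
noncomputable def EDD {N : ℕ} (G : SimpleGraph (Fin N)) (S : Finset (Fin N))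
    (P₀ P₁ P₂ : Measure ℝ) (T : Obs G → WithTop ℕ) : ℝ≥0∞ :=
  ⨆ (κ : ℕ) (_ : 1 ≤ κ),
    essSup
      (condLExp (obsFiltration G Set.univ (κ - 1)) (changeLaw G S P₀ P₁ P₂ κ)
        (fun ω => ENat.toENNReal (T ω) + 1 - (κ : ℝ≥0∞)))
      (changeLaw G S P₀ P₁ P₂ κ)

end SimNet

/-! All similarities of one time step form a single observation. On the visible edges its
post-change law has a density `l` with respect to the pre-change law: the product of dP₁/dP₀ over
the cut edges. After the change, log l has mean I = cut(S)·KL(P₁‖P₀). What remains is Lorden's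
problem for a sequence of independent terms, governed by Page's CUSUM V₀ = 0, V_{n+1} = max(V_n,
1)·l.

Lower bound, in the manner of Moustakides. By `max_cusum_eq_sum`, max(V_n, 1) is a mixture of
likelihood ratios over the change points k, with weights (1 - V_k)⁺ known at time k. If every delay
is at most d, weighting the delays in this way gives Σ E^∞[max(V_n, 1); T > n] ≤ d Σ E^∞[(1 - V_n)⁺;
T > n] (`sum_setLIntegral_max_cusum_le`). Put W = max(V_{T∧N}, 1) and a = E^∞[W]. Then a - 1 is the
second sum with V_{n+1} in place of V_n, and E^∞[W log W] is at most I times the first sum plus a -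
1, hence at most (I d + 1) a; Jensen's inequality yields log a ≤ I d + 1. Finally √l has mean ρ < 1
before the change, which forces (1 - ρ) E^∞[T∧N] ≤ a (`sum_measure_le`), and N → ∞ gives log γ ≤ I d
+ O(1).

Upper bound. The CUSUM test with threshold B = 2γ works. Before the change V grows in mean by at
most one per step, so the run length is at least B/2 on average (`le_two_mul_tsum_below`). After a
change at k, V dominates the likelihood ratio restarted at k, whose logarithm is a random walk with
drift I; a potential function (`exists_potential`) bounds its mean time to pass log B by (log B +
C)/I, whatever the past. The second moment of log l controls the overshoot. -/

namespace SimNet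

open scoped NNReal

/-! ### Change of measure for infinite products -/

section ChangeOfMeasure

variable {ι : Type*} {X : ι → Type*} {m mX : ∀ i, MeasurableSpace (X i)}

/-- The σ-algebra generated by the coordinates in `U`, the `i`-th one seen through `m i`. -/
@[reducible]
def coordAlgebra (m : ∀ i, MeasurableSpace (X i)) (U : Set ι) : MeasurableSpace (∀ i, X i) :=
  ⨆ i ∈ U, (m i).comap fun x : ∀ i, X i => x i

/-- A product measure whose factors have densities `d i` on sub-σ-algebras `m i` has the product
density on the σ-algebra that is generated by the coordinates seen through `m i`. -/
theorem lintegral_infinitePi_eq_lintegral_mul_prod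
    (hm : ∀ i, m i ≤ mX i) (μ ν : ∀ i, Measure (X i))
    [∀ i, IsProbabilityMeasure (μ i)] [∀ i, IsProbabilityMeasure (ν i)]
    (s : Finset ι) (U : Set ι) (hU : U ⊆ s) (d : ∀ i, X i → ℝ≥0∞)
    (hd : ∀ i, Measurable (d i)) (hd1 : ∀ i ∈ s, ∫⁻ x, d i x ∂μ i = 1)
    (hν : ∀ i ∈ U, ∀ B, MeasurableSet[m i] B → ν i B = ∫⁻ x in B, d i x ∂μ i)
    {f : (∀ i, X i) → ℝ≥0∞}
    (hf : Measurable[coordAlgebra m U] f) :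
    ∫⁻ x, f x ∂(Measure.infinitePi ν)
      = ∫⁻ x, f x * ∏ i ∈ s, d i (x i) ∂(Measure.infinitePi μ) := by
  classical
  have hle : coordAlgebra m U ≤ MeasurableSpace.pi := iSup₂_le fun i _ =>
    (MeasurableSpace.comap_mono (hm i)).trans (measurable_pi_apply i).comap_le
  have hD : Measurable fun x : ∀ i, X i => ∏ i ∈ s, d i (x i) :=
    Finset.measurable_prod _ fun i _ => (hd i).comp (measurable_pi_apply i)
  have hindep (g : ∀ i, X i → ℝ≥0∞) (hg : ∀ i, Measurable (g i)) :
      ∫⁻ x, ∏ i ∈ s, g i (x i) ∂(Measure.infinitePi μ) = ∏ i ∈ s, ∫⁻ x, g i x ∂μ i := by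
    rw [lintegral_prod_eq_prod_lintegral_of_indepFun s (fun i (x : ∀ i, X i) => g i (x i))
      (iIndepFun_infinitePi hg) fun i => (hg i).comp (measurable_pi_apply i)]
    refine Finset.prod_congr rfl fun i _ => ?_
    conv_rhs => rw [← Measure.infinitePi_map_eval μ i]
    exact (lintegral_map (hg i) (measurable_pi_apply i)).symm
  set Q := (Measure.infinitePi μ).withDensity fun x => ∏ i ∈ s, d i (x i) with hQ
  have hQuniv : Q Set.univ = 1 := by
    rw [hQ, withDensity_apply _ .univ, setLIntegral_univ, hindep d hd, Finset.prod_congr rfl hd1]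
    simp
  have : IsProbabilityMeasure Q := ⟨hQuniv⟩
  -- Both measures are compared on finite cylinders over coordinates in `U`, a π-system that
  -- generates the σ-algebra.
  have key : (Measure.infinitePi ν).trim hle = Q.trim hle := by
    refine ext_of_generate_finite
      (piiUnionInter (fun i => {A | MeasurableSet[(m i).comap (fun x : ∀ i, X i => x i)] A}) U)
      ?_ ?_ ?_ ?_
    · exact (generateFrom_piiUnionInter_measurableSet
        (fun i => (m i).comap fun x : ∀ i, X i => x i) U).symm
    · exact isPiSystem_piiUnionInter _
        (fun i => @MeasurableSpace.isPiSystem_measurableSet _ ((m i).comap _)) _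
    · intro A hA
      have hA𝓖 : MeasurableSet[coordAlgebra m U] A := measurableSet_iSup_of_mem_piiUnionInter _ _ _ hA
      rw [trim_measurableSet_eq hle hA𝓖, trim_measurableSet_eq hle hA𝓖]
      obtain ⟨t, htU, F, hF, rfl⟩ := hA
      choose! B hB hBF using hF
      have hts : t ⊆ s := fun i hi => hU (htU hi)
      have hA' : (⋂ i ∈ t, F i) = Set.pi t B := by
        ext x
        simp only [Set.mem_iInter, Set.mem_pi]
        refine forall₂_congr fun i hi => ?_
        rw [← hBF i hi]
        rfl
      have hBm : ∀ i ∈ t, MeasurableSet (B i) := fun i hi => hm i _ (hB i hi)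
      have hpi : MeasurableSet (Set.pi (t : Set ι) B) :=
        MeasurableSet.pi t.countable_toSet fun i hi => hBm i hi
      rw [hA', Measure.infinitePi_pi _ hBm, hQ, withDensity_apply _ hpi, ← lintegral_indicator hpi]
      -- The cylinder's indicator is absorbed into the density factors, so the integral factorizes;
      -- the factors outside `t` integrate to one.
      set g : ∀ i, X i → ℝ≥0∞ := fun i => if i ∈ t then (B i).indicator (d i) else d i with hg
      have hgm : ∀ i, Measurable (g i) := by
        intro i
        by_cases hi : i ∈ t
        · simpa [hg, hi] using (hd i).indicator (hBm i hi)
        · simpa [hg, hi] using hd i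
      have hgprod : ∀ x, (Set.pi (t : Set ι) B).indicator (fun x => ∏ i ∈ s, d i (x i)) x
          = ∏ i ∈ s, g i (x i) := by
        intro x
        by_cases hx : x ∈ Set.pi (t : Set ι) B
        · rw [Set.indicator_of_mem hx]
          refine Finset.prod_congr rfl fun i _ => ?_
          by_cases hi : i ∈ t
          · simp only [hg, if_pos hi]
            rw [Set.indicator_of_mem (hx i hi)]
          · simp [hg, hi]
        · rw [Set.indicator_of_notMem hx]
          simp only [Set.mem_pi, not_forall] at hx
          obtain ⟨i, hi, hix⟩ := hx
          refine (Finset.prod_eq_zero (hts hi) ?_).symm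
          have hi' : i ∈ t := hi
          simp only [hg, if_pos hi']
          exact Set.indicator_of_notMem hix _
      simp_rw [hgprod]
      rw [hindep g hgm, ← Finset.prod_subset hts]
      · refine Finset.prod_congr rfl fun i hi => ?_
        simp only [hg, if_pos hi]
        rw [lintegral_indicator (hBm i hi), hν i (htU hi) _ (hB i hi)]
      · intro i his hit
        simp only [hg, if_neg hit]
        exact hd1 i his
    · rw [trim_measurableSet_eq hle MeasurableSet.univ, trim_measurableSet_eq hle MeasurableSet.univ,
        measure_univ, measure_univ]
  rw [← lintegral_trim hle hf, key, lintegral_trim hle hf, hQ,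
    lintegral_withDensity_eq_lintegral_mul _ hD (hf.mono hle le_rfl)]
  simp_rw [Pi.mul_apply, mul_comm]

end ChangeOfMeasure

/-! ### Essential suprema of conditional expectations as weighted inequalities -/

section CondLExp

variable {Ω : Type*} {𝓕 mΩ : MeasurableSpace Ω}

theorem lintegral_mul_condLExp (h𝓕 : 𝓕 ≤ mΩ) (P : Measure Ω) [IsProbabilityMeasure P]
    {f w : Ω → ℝ≥0∞} (hf : Measurable f) (hw : Measurable[𝓕] w) :
    ∫⁻ ω, w ω * condLExp 𝓕 P f ω ∂P = ∫⁻ ω, w ω * f ω ∂P := by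
  have hc : Measurable (condLExp 𝓕 P f) := measurable_condLExp' 𝓕 P f
  have key : (P.withDensity (condLExp 𝓕 P f)).trim h𝓕 = (P.withDensity f).trim h𝓕 := by
    refine @Measure.ext _ 𝓕 _ _ fun A hA => ?_
    rw [trim_measurableSet_eq h𝓕 hA, trim_measurableSet_eq h𝓕 hA,
      withDensity_apply _ (h𝓕 A hA), withDensity_apply _ (h𝓕 A hA), setLIntegral_condLExp h𝓕 P f hA]
  have hw' : Measurable w := hw.mono h𝓕 le_rfl
  have e := congrArg (fun μ : Measure[𝓕] Ω => ∫⁻ ω, w ω ∂μ) key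
  simp only [lintegral_trim h𝓕 hw] at e
  rw [lintegral_withDensity_eq_lintegral_mul _ hc hw',
    lintegral_withDensity_eq_lintegral_mul _ hf hw'] at e
  simpa [Pi.mul_apply, mul_comm] using e

/-- This is the form in which the lower bound uses the worst-case delay: weights that depend on the
past may be chosen freely. -/
theorem lintegral_mul_le_essSup_condLExp (h𝓕 : 𝓕 ≤ mΩ) (P : Measure Ω) [IsProbabilityMeasure P]
    {f w : Ω → ℝ≥0∞} (hf : Measurable f) (hw : Measurable[𝓕] w) :
    ∫⁻ ω, w ω * f ω ∂P ≤ essSup (condLExp 𝓕 P f) P * ∫⁻ ω, w ω ∂P := by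
  rw [← lintegral_mul_condLExp h𝓕 P hf hw, ← lintegral_const_mul _ (hw.mono h𝓕 le_rfl)]
  refine lintegral_mono_ae ?_
  filter_upwards [ENNReal.ae_le_essSup (condLExp 𝓕 P f)] with ω hω
  rw [mul_comm]
  gcongr

/-- The converse, for the upper bound: testing on events of the past suffices. -/
theorem essSup_condLExp_le (h𝓕 : 𝓕 ≤ mΩ) (P : Measure Ω) [IsProbabilityMeasure P]
    {f : Ω → ℝ≥0∞} {c : ℝ≥0∞}
    (h : ∀ A, MeasurableSet[𝓕] A → ∫⁻ ω in A, f ω ∂P ≤ c * P A) :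
    essSup (condLExp 𝓕 P f) P ≤ c := by
  refine essSup_le_of_ae_le c ?_
  refine ae_le_of_ae_le_trim (hm := h𝓕) ?_
  refine ae_le_of_forall_setLIntegral_le_of_sigmaFinite (measurable_condLExp 𝓕 P f) ?_
  intro A hA _
  rw [setLIntegral_condLExp_trim h𝓕 P f hA, setLIntegral_const, trim_measurableSet_eq h𝓕 hA]
  exact h A hA

end CondLExp

/-! ### Sequences of independent terms -/

section Sequences

variable {E : Type*}

/-- The σ-algebra of the first `n` terms of a sequence in `E`, each seen through `m`. -/
@[reducible]
def past (m : MeasurableSpace E) (n : ℕ) : MeasurableSpace (ℕ → E) :=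
  coordAlgebra (fun _ => m) (Set.Iio n)

theorem past_mono (m : MeasurableSpace E) {i j : ℕ} (hij : i ≤ j) : past m i ≤ past m j :=
  biSup_mono fun _ hk => lt_of_lt_of_le hk hij

theorem past_mono_left {m m' : MeasurableSpace E} (hm : m ≤ m') (n : ℕ) :
    past m n ≤ past m' n :=
  iSup₂_mono fun _ _ => MeasurableSpace.comap_mono hm

theorem past_le {m mE : MeasurableSpace E} (hm : m ≤ mE) (n : ℕ) :
    past m n ≤ MeasurableSpace.pi :=
  iSup₂_le fun i _ => (MeasurableSpace.comap_mono hm).trans (measurable_pi_apply i).comap_le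

theorem measurable_eval_past (m : MeasurableSpace E) {k n : ℕ} (hk : k < n) :
    Measurable[past m n, m] fun ω : ℕ → E => ω k :=
  measurable_iff_comap_le.2 (le_biSup (fun k => m.comap fun ω : ℕ → E => ω k) hk)

/-- The term with index `n` is independent of the first `n` terms, so by Fubini it can be integrated
out with `z` frozen. -/
theorem lintegral_apply_eval {mE : MeasurableSpace E} (ν : ℕ → Measure E)
    [∀ k, IsProbabilityMeasure (ν k)] {Z : Type*} [MeasurableSpace Z] {n : ℕ} {z : (ℕ → E) → Z}
    (hz : Measurable[past mE n] z) {H : Z → E → ℝ≥0∞} (hH : Measurable (Function.uncurry H)) :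
    ∫⁻ ω, H (z ω) (ω n) ∂(Measure.infinitePi ν)
      = ∫⁻ ω, ∫⁻ x, H (z ω) x ∂ν n ∂(Measure.infinitePi ν) := by
  have hz' : Measurable z := hz.mono (past_le le_rfl n) le_rfl
  have hi : iIndep (fun k => mE.comap fun ω : ℕ → E => ω k) (Measure.infinitePi ν) :=
    iIndepFun_infinitePi (X := fun _ x => x) fun _ => measurable_id
  have hind : IndepFun z (fun ω : ℕ → E => ω n) (Measure.infinitePi ν) := by
    have h2 := indep_iSup_of_disjoint (fun k => (measurable_pi_apply k).comap_le) hi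
      (S := Set.Iio n) (T := {n}) (by simp)
    refine indep_of_indep_of_le_left (indep_of_indep_of_le_right h2 ?_) hz.comap_le
    simp
  have hmap := (indepFun_iff_map_prod_eq_prod_map_map hz'.aemeasurable
    (measurable_pi_apply n).aemeasurable).1 hind
  rw [Measure.infinitePi_map_eval] at hmap
  calc ∫⁻ ω, H (z ω) (ω n) ∂(Measure.infinitePi ν)
      = ∫⁻ p, Function.uncurry H p
          ∂((Measure.infinitePi ν).map fun ω => (z ω, ω n)) := by
        rw [lintegral_map hH (hz'.prodMk (measurable_pi_apply n))]
        rfl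
    _ = ∫⁻ y, ∫⁻ x, H y x ∂ν n ∂((Measure.infinitePi ν).map z) := by
        have := Measure.isProbabilityMeasure_map (μ := Measure.infinitePi ν) hz'.aemeasurable
        rw [hmap, lintegral_prod _ hH.aemeasurable]
        rfl
    _ = _ := by
        exact lintegral_map hH.lintegral_prod_right' hz'

end Sequences

section Sequences

variable {E : Type*}

theorem setLIntegral_apply_eval {mE : MeasurableSpace E} (ν : ℕ → Measure E)
    [∀ k, IsProbabilityMeasure (ν k)] {Z : Type*} [MeasurableSpace Z] {n : ℕ} {z : (ℕ → E) → Z}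
    (hz : Measurable[past mE n] z) {A : Set (ℕ → E)} (hA : MeasurableSet[past mE n] A)
    {H : Z → E → ℝ≥0∞} (hH : Measurable (Function.uncurry H)) :
    ∫⁻ ω in A, H (z ω) (ω n) ∂(Measure.infinitePi ν)
      = ∫⁻ ω in A, ∫⁻ x, H (z ω) x ∂ν n ∂(Measure.infinitePi ν) := by
  have hA' := past_le le_rfl n A hA
  have hind : Measurable[past mE n] (A.indicator (1 : (ℕ → E) → ℝ≥0∞)) :=
    measurable_const.indicator hA
  have hmul : ∀ (ω : ℕ → E) (c : ℝ≥0∞), A.indicator 1 ω * c = A.indicator (fun _ => c) ω := by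
    intro ω c
    by_cases h : ω ∈ A <;> simp [h]
  -- The indicator of `A` is itself a function of the past and joins `z` as a further component.
  have key := lintegral_apply_eval ν (z := fun ω => (A.indicator (1 : (ℕ → E) → ℝ≥0∞) ω, z ω))
    (hind.prodMk hz) (H := fun p x => p.1 * H p.2 x)
    (by
      exact (measurable_fst.comp measurable_fst).mul (hH.comp
        ((measurable_snd.comp measurable_fst).prodMk measurable_snd) :
          Measurable fun q : (ℝ≥0∞ × Z) × E => H q.1.2 q.2))
  have hHx : ∀ y, Measurable fun x => H y x := fun y => hH.comp measurable_prodMk_left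
  rw [← lintegral_indicator hA', ← lintegral_indicator hA']
  simp only [lintegral_const_mul _ (hHx _)] at key
  simp only [hmul] at key
  exact key

end Sequences

/-! ### Densities valid on a sub-σ-algebra only -/

section Trim

variable {E : Type*} {m mE : MeasurableSpace E} {μ₀ μ₁ : Measure E} {l : E → ℝ≥0}

/-- The full post-change law need not have density `l`, since `P₂` is arbitrary on the unseen edges.
Everything visible is `m`-measurable, and for this the trimmed measures suffice. -/
theorem trim_eq_trim_withDensity (hm : m ≤ mE)
    (hμ : ∀ B, MeasurableSet[m] B → μ₁ B = ∫⁻ x in B, l x ∂μ₀) :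
    μ₁.trim hm = (μ₀.withDensity fun x => (l x : ℝ≥0∞)).trim hm := by
  refine @Measure.ext _ m _ _ fun B hB => ?_
  rw [trim_measurableSet_eq hm hB, trim_measurableSet_eq hm hB, withDensity_apply _ (hm B hB),
    hμ B hB]

theorem integrable_mul_of_trim (hm : m ≤ mE) (hl : Measurable[m] l)
    (hμ : ∀ B, MeasurableSet[m] B → μ₁ B = ∫⁻ x in B, l x ∂μ₀) {g : E → ℝ}
    (hg : Measurable[m] g) (hint : Integrable g μ₁) :
    Integrable (fun x => (l x : ℝ) * g x) μ₀ := by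
  have h1 := hint.trim hm hg.stronglyMeasurable
  rw [trim_eq_trim_withDensity hm hμ] at h1
  have h2 := integrable_of_integrable_trim hm h1
  exact (integrable_withDensity_iff_integrable_smul (hl.mono hm le_rfl)).1 h2

theorem integral_mul_of_trim (hm : m ≤ mE) (hl : Measurable[m] l)
    (hμ : ∀ B, MeasurableSet[m] B → μ₁ B = ∫⁻ x in B, l x ∂μ₀) {g : E → ℝ}
    (hg : Measurable[m] g) :
    ∫ x, (l x : ℝ) * g x ∂μ₀ = ∫ x, g x ∂μ₁ := by
  rw [integral_trim hm hg.stronglyMeasurable, trim_eq_trim_withDensity hm hμ,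
    ← integral_trim hm hg.stronglyMeasurable,
    integral_withDensity_eq_integral_smul (hl.mono hm le_rfl)]
  rfl

theorem lintegral_density_eq_one [IsProbabilityMeasure μ₁]
    (hμ : ∀ B, MeasurableSet[m] B → μ₁ B = ∫⁻ x in B, l x ∂μ₀) : ∫⁻ x, l x ∂μ₀ = 1 := by
  rw [← setLIntegral_univ, ← hμ _ MeasurableSet.univ, measure_univ]

end Trim

/-! ### The CUSUM statistic as a mixture over change points -/

section Cusum

variable {E : Type*}

/-- Page's CUSUM statistic for the one-step likelihood ratio `l`. -/
noncomputable def cusum (l : E → ℝ≥0) : ℕ → (ℕ → E) → ℝ≥0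
  | 0, _ => 0
  | n + 1, ω => max (cusum l n ω) 1 * l (ω n)

/-- The likelihood ratio of the terms with indices in `[k, n)`. -/
noncomputable def lr (l : E → ℝ≥0) (k n : ℕ) (ω : ℕ → E) : ℝ≥0 :=
  ∏ j ∈ Finset.Ico k n, l (ω j)

/-- The law of a sequence of independent terms with law `μ₀` before the index `k` and `μ₁` from
this index on. -/
noncomputable def changeSeq {mE : MeasurableSpace E} (μ₀ μ₁ : Measure E) (k : ℕ) :
    Measure (ℕ → E) :=
  Measure.infinitePi fun j => if j < k then μ₀ else μ₁

/-- Subtraction is truncated, so max(V, 1) = (1 - V) + V; the last term is expanded by the recursion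
of V and the induction hypothesis. The weight 1 - V_k depends on the first `k` terms only, as the
delay condition for a change at `k` requires. -/
theorem max_cusum_eq_sum (l : E → ℝ≥0) (n : ℕ) (ω : ℕ → E) :
    max (cusum l n ω) 1 = ∑ k ∈ Finset.range (n + 1), (1 - cusum l k ω) * lr l k n ω := by
  induction n with
  | zero => simp [cusum, lr]
  | succ n ih =>
    rw [Finset.sum_range_succ, ← add_tsub_eq_max]
    simp only [lr, Finset.Ico_self, Finset.prod_empty, mul_one, add_left_inj]
    rw [cusum, ih, Finset.sum_mul]
    refine Finset.sum_congr rfl fun k hk => ?_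
    rw [Finset.prod_Ico_succ_top (by simpa [Nat.lt_succ_iff] using hk), mul_assoc, lr]

theorem lr_succ (l : E → ℝ≥0) {k n : ℕ} (h : k ≤ n) (ω : ℕ → E) :
    lr l k (n + 1) ω = lr l k n ω * l (ω n) :=
  Finset.prod_Ico_succ_top h _

/-- The CUSUM never does worse than restarting from 1 at `k`. For `n = k` this can fail: the empty
product is 1, while the statistic may be smaller. -/
theorem lr_le_cusum (l : E → ℝ≥0) {k n : ℕ} (h : k < n) (ω : ℕ → E) :
    lr l k n ω ≤ cusum l n ω := by
  induction n, h using Nat.le_induction with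
  | base => simpa [lr, cusum] using le_mul_of_one_le_left' (le_max_right _ _)
  | succ n hn ih =>
    rw [lr_succ l (by omega), cusum]
    gcongr
    exact ih.trans (le_max_left _ _)

variable {m : MeasurableSpace E} {l : E → ℝ≥0}

theorem measurable_cusum (hl : Measurable[m] l) (n : ℕ) : Measurable[past m n] (cusum l n) := by
  induction n with
  | zero => exact measurable_const
  | succ n ih =>
    have h1 : Measurable[past m (n + 1)] (cusum l n) := ih.mono (past_mono m n.le_succ) le_rfl
    have h2 : Measurable[past m (n + 1)] fun ω : ℕ → E => l (ω n) :=
      hl.comp (measurable_eval_past m n.lt_succ_self)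
    exact (h1.max measurable_const).mul h2

theorem measurable_lr (hl : Measurable[m] l) (k n : ℕ) : Measurable[past m n] (lr l k n) :=
  Finset.measurable_prod _ fun _ hj =>
    hl.comp (measurable_eval_past m (Finset.mem_Ico.1 hj).2)

variable {mE : MeasurableSpace E} {μ₀ μ₁ : Measure E} [IsProbabilityMeasure μ₀]
  [IsProbabilityMeasure μ₁]

instance (k : ℕ) : IsProbabilityMeasure (changeSeq μ₀ μ₁ k) := by
  have : ∀ j, IsProbabilityMeasure (if j < k then μ₀ else μ₁) := by
    intro j
    split_ifs <;> infer_instance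
  unfold changeSeq
  infer_instance

theorem lintegral_changeSeq (hm : m ≤ mE) (hl : Measurable[m] l)
    (hμ : ∀ B, MeasurableSet[m] B → μ₁ B = ∫⁻ x in B, l x ∂μ₀) {k n : ℕ}
    {f : (ℕ → E) → ℝ≥0∞} (hf : Measurable[past m n] f) :
    ∫⁻ ω, f ω ∂(changeSeq μ₀ μ₁ k)
      = ∫⁻ ω, f ω * lr l k n ω ∂(Measure.infinitePi fun _ => μ₀) := by
  have : ∀ j, IsProbabilityMeasure (if j < k then μ₀ else μ₁) := by
    intro j
    split_ifs <;> infer_instance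
  have hl' : Measurable fun x => (l x : ℝ≥0∞) := (hl.mono hm le_rfl).coe_nnreal_ennreal
  rw [changeSeq, lintegral_infinitePi_eq_lintegral_mul_prod (m := fun _ => m) (fun _ => hm)
    (fun _ => μ₀) (fun j => if j < k then μ₀ else μ₁) (Finset.range n) (Set.Iio n) (by simp)
    (fun j x => if j < k then 1 else (l x : ℝ≥0∞)) ?_ ?_ ?_ hf]
  · refine lintegral_congr fun ω => ?_
    congr 1
    rw [lr, ENNReal.ofNNReal_finsetProd]
    symm
    have hsub : Finset.Ico k n ⊆ Finset.range n := fun j hj => by simp_all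
    rw [← Finset.prod_subset hsub]
    · refine Finset.prod_congr rfl fun j hj => ?_
      rw [if_neg (by simp at hj; omega)]
    · intro j hj hj'
      rw [if_pos (by simp at hj hj'; omega)]
  · intro j
    split_ifs
    exacts [measurable_const, hl']
  · intro j _
    split_ifs
    exacts [by simp, lintegral_density_eq_one hμ]
  · intro j _ B hB
    split_ifs
    exacts [by simp, hμ B hB]

/-- The delay bound for a change at `k` is applied with the weight (1 - V_k)⁺ on `A k`, moved to the
no-change law by the likelihood ratio, and summed over `k`. Exchanging the two sums reassembles
max(V_n, 1). -/
theorem sum_setLIntegral_max_cusum_le (hm : m ≤ mE) (hl : Measurable[m] l)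
    (hμ : ∀ B, MeasurableSet[m] B → μ₁ B = ∫⁻ x in B, l x ∂μ₀)
    {A : ℕ → Set (ℕ → E)} (hA : ∀ n, MeasurableSet[past m n] (A n)) (hanti : Antitone A)
    {d : ℝ≥0∞} {N : ℕ}
    (hd : ∀ k, ∀ w : (ℕ → E) → ℝ≥0∞, Measurable[past m k] w →
      ∑ n ∈ Finset.Ico k N, ∫⁻ ω in A n, w ω ∂(changeSeq μ₀ μ₁ k)
        ≤ d * ∫⁻ ω, w ω ∂(changeSeq μ₀ μ₁ k)) :
    ∑ n ∈ Finset.range N, ∫⁻ ω in A n, (max (cusum l n ω) 1 : ℝ≥0)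
        ∂(Measure.infinitePi fun _ => μ₀)
      ≤ d * ∑ n ∈ Finset.range N, ∫⁻ ω in A n, (1 - cusum l n ω : ℝ≥0)
        ∂(Measure.infinitePi fun _ => μ₀) := by
  set P := Measure.infinitePi fun _ : ℕ => μ₀ with hP
  have hA' : ∀ n, MeasurableSet (A n) := fun n => past_le hm n _ (hA n)
  have hVm : ∀ k, Measurable[past m k] fun ω => ((1 - cusum l k ω : ℝ≥0) : ℝ≥0∞) := fun k =>
    (measurable_const.sub (measurable_cusum hl k)).coe_nnreal_ennreal
  have hVm' : ∀ k, Measurable fun ω => ((1 - cusum l k ω : ℝ≥0) : ℝ≥0∞) := fun k =>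
    (hVm k).mono (past_le hm k) le_rfl
  have hLm : ∀ k n, Measurable fun ω => ((lr l k n ω : ℝ≥0) : ℝ≥0∞) := fun k n =>
    ((measurable_lr hl k n).mono (past_le hm n) le_rfl).coe_nnreal_ennreal
  have hset : ∀ k n, k ≤ n → ∫⁻ ω in A n, (A k).indicator
        (fun ω => ((1 - cusum l k ω : ℝ≥0) : ℝ≥0∞)) ω ∂(changeSeq μ₀ μ₁ k)
      = ∫⁻ ω in A n, ((1 - cusum l k ω : ℝ≥0) : ℝ≥0∞) * lr l k n ω ∂P := by
    intro k n hkn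
    have hfm : Measurable[past m n] ((A n).indicator
        fun ω => ((1 - cusum l k ω : ℝ≥0) : ℝ≥0∞)) :=
      ((hVm k).mono (past_mono m hkn) le_rfl).indicator (hA n)
    have e : ∀ ω, (A n).indicator ((A k).indicator
        fun ω => ((1 - cusum l k ω : ℝ≥0) : ℝ≥0∞)) ω = (A n).indicator
        (fun ω => ((1 - cusum l k ω : ℝ≥0) : ℝ≥0∞)) ω := by
      intro ω
      rw [Set.indicator_indicator, Set.inter_eq_left.2 (hanti hkn)]
    rw [← lintegral_indicator (hA' n), lintegral_congr e, lintegral_changeSeq hm hl hμ hfm,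
      ← lintegral_indicator (hA' n)]
    refine lintegral_congr fun ω => ?_
    by_cases h : ω ∈ A n <;> simp [h]
  have hk : ∀ k, ∑ n ∈ Finset.Ico k N,
        ∫⁻ ω in A n, ((1 - cusum l k ω : ℝ≥0) : ℝ≥0∞) * lr l k n ω ∂P
      ≤ d * ∫⁻ ω in A k, (1 - cusum l k ω : ℝ≥0) ∂P := by
    intro k
    -- Restricting the weight to `A k` costs nothing on the left, because `A n ⊆ A k` for `n ≥ k`,
    -- and it produces the integral over `A k` on the right.
    have h := hd k ((A k).indicator fun ω => ((1 - cusum l k ω : ℝ≥0) : ℝ≥0∞))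
      ((hVm k).indicator (hA k))
    have hw := lintegral_changeSeq (k := k) hm hl hμ ((hVm k).indicator (hA k))
    rw [Finset.sum_congr rfl fun n hn => hset k n (Finset.mem_Ico.1 hn).1] at h
    refine h.trans (le_of_eq ?_)
    rw [hw, ← lintegral_indicator (hA' k)]
    simp [lr, hP]
  rw [Finset.mul_sum]
  refine le_trans (le_of_eq ?_) (Finset.sum_le_sum fun k _ => hk k)
  rw [Finset.sum_comm' (t' := Finset.range N) (s' := fun n => Finset.range (n + 1))]
  · refine Finset.sum_congr rfl fun n _ => ?_
    have hsum := lintegral_finsetSum (μ := P.restrict (A n)) (Finset.range (n + 1))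
      (f := fun k ω => ((1 - cusum l k ω : ℝ≥0) : ℝ≥0∞) * lr l k n ω)
      fun k _ => (hVm' k).mul (hLm k n)
    rw [← hsum]
    refine lintegral_congr fun ω => ?_
    rw [max_cusum_eq_sum, ENNReal.ofNNReal_finsetSum]
    simp
  · intro k n
    simp only [Finset.mem_range, Finset.mem_Ico]
    omega

end Cusum

/-! ### Stopped processes -/

section Stopped

variable {Ω β : Type*}

open Classical in
/-- The process `X` stopped at the first time `n` with `ω ∉ A n`. -/
noncomputable def stopped (A : ℕ → Set Ω) (X : ℕ → Ω → β) : ℕ → Ω → β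
  | 0, ω => X 0 ω
  | n + 1, ω => if ω ∈ A n then X (n + 1) ω else stopped A X n ω

theorem stopped_of_mem {A : ℕ → Set Ω} (hanti : Antitone A) (X : ℕ → Ω → β) {n : ℕ} {ω : Ω}
    (h : ω ∈ A n) : stopped A X n ω = X n ω := by
  cases n with
  | zero => rfl
  | succ n => exact if_pos (hanti n.le_succ h)

/-- Optional stopping, one step at a time. It is stated with sums on both sides because differences
in `ℝ≥0∞` are truncated. -/
theorem lintegral_stopped_succ {mΩ : MeasurableSpace Ω} (P : Measure Ω) {A : ℕ → Set Ω}
    (hA : ∀ n, MeasurableSet (A n)) (hanti : Antitone A) (X : ℕ → Ω → β) (g : β → ℝ≥0∞) (n : ℕ) :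
    ∫⁻ ω, g (stopped A X (n + 1) ω) ∂P + ∫⁻ ω in A n, g (X n ω) ∂P
      = ∫⁻ ω, g (stopped A X n ω) ∂P + ∫⁻ ω in A n, g (X (n + 1) ω) ∂P := by
  rw [← lintegral_add_compl (fun ω => g (stopped A X (n + 1) ω)) (hA n),
    ← lintegral_add_compl (fun ω => g (stopped A X n ω)) (hA n)]
  have e1 : ∫⁻ ω in A n, g (stopped A X (n + 1) ω) ∂P = ∫⁻ ω in A n, g (X (n + 1) ω) ∂P :=
    setLIntegral_congr_fun (hA n) fun ω hω => congrArg g (if_pos hω)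
  have e2 : ∫⁻ ω in (A n)ᶜ, g (stopped A X (n + 1) ω) ∂P
      = ∫⁻ ω in (A n)ᶜ, g (stopped A X n ω) ∂P :=
    setLIntegral_congr_fun (hA n).compl fun ω hω => congrArg g (if_neg hω)
  have e3 : ∫⁻ ω in A n, g (stopped A X n ω) ∂P = ∫⁻ ω in A n, g (X n ω) ∂P :=
    setLIntegral_congr_fun (hA n) fun ω hω => congrArg g (stopped_of_mem hanti X hω)
  rw [e1, e2, e3]
  ring

end Stopped

/-- The positive part of `v log v`. -/
noncomputable def entropy (v : ℝ≥0) : ℝ≥0∞ := ENNReal.ofReal (v * Real.log v)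

theorem measurable_entropy : Measurable entropy := by
  unfold entropy
  fun_prop

/-! ### One-step estimates for the likelihood ratio -/

section OneStep

variable {E : Type*} {mE : MeasurableSpace E} {μ₀ : Measure E} [IsProbabilityMeasure μ₀]
  {l : E → ℝ≥0}

/-- With y = c·l, one has y log y = (c log c)·l + c·(l log l), and l has mean one. The term (1 - y)⁺
pays for replacing y by max(y, 1), since y log y ≥ y - 1. -/
theorem lintegral_entropy_le (hl : Measurable l) (hone : ∫⁻ x, l x ∂μ₀ = 1)
    (hint : Integrable (fun x => (l x : ℝ) * Real.log (l x)) μ₀)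
    (hI : 0 ≤ ∫ x, (l x : ℝ) * Real.log (l x) ∂μ₀) {c : ℝ≥0} (hc : 1 ≤ c) :
    ∫⁻ x, entropy (max (c * l x) 1) ∂μ₀
      ≤ entropy c + ENNReal.ofReal (∫ x, (l x : ℝ) * Real.log (l x) ∂μ₀) * c
        + ∫⁻ x, (1 - c * l x : ℝ≥0) ∂μ₀ := by
  set I := ∫ x, (l x : ℝ) * Real.log (l x) ∂μ₀ with hIdef
  have hc0 : (0 : ℝ) < c := by exact_mod_cast lt_of_lt_of_le one_pos hc
  have hlog : 0 ≤ Real.log c := Real.log_nonneg (by exact_mod_cast hc)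
  have hlint : Integrable (fun x => (l x : ℝ)) μ₀ := by
    refine ⟨hl.coe_nnreal_real.aestronglyMeasurable, ?_⟩
    simp [HasFiniteIntegral, hone]
  have hl1 : ∫ x, (l x : ℝ) ∂μ₀ = 1 := by
    rw [integral_eq_lintegral_of_nonneg_ae (Filter.Eventually.of_forall fun _ => NNReal.coe_nonneg _)
      hl.coe_nnreal_real.aestronglyMeasurable]
    simp [hone]
  have hsubm : Measurable fun x => 1 - c * l x := measurable_const.sub (hl.const_mul c)
  have hsub : Integrable (fun x => ((1 - c * l x : ℝ≥0) : ℝ)) μ₀ := by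
    refine Integrable.of_bound (C := 1) hsubm.coe_nnreal_real.aestronglyMeasurable
      (Filter.Eventually.of_forall fun x => ?_)
    simp only [NNReal.norm_eq]
    exact_mod_cast tsub_le_self
  set g : E → ℝ := fun x => (c * Real.log c) * l x + c * (l x * Real.log (l x))
    + ((1 - c * l x : ℝ≥0) : ℝ) with hg
  have hpt : ∀ x, 0 ≤ g x ∧ entropy (max (c * l x) 1) ≤ ENNReal.ofReal (g x) := by
    intro x
    have hy : (c * Real.log c) * l x + c * (l x * Real.log (l x))
        = (c * l x) * Real.log (c * l x) := by
      rcases eq_or_ne (l x) 0 with h0 | h0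
      · simp [h0]
      · rw [Real.log_mul hc0.ne' (by exact_mod_cast h0)]
        ring
    rcases le_total (c * l x) 1 with h | h
    · have hr : (c : ℝ) * l x ≤ 1 := by exact_mod_cast h
      have hnn : (0 : ℝ) ≤ c * l x := by positivity
      have hgx : 0 ≤ g x := by
        simp only [hg, hy, NNReal.coe_sub h, NNReal.coe_mul, NNReal.coe_one]
        rcases eq_or_lt_of_le hnn with h0 | h0
        · simp [← h0]
        · have := Real.one_sub_inv_le_log_of_pos h0
          have h2 := mul_le_mul_of_nonneg_left this hnn
          rw [mul_sub, mul_inv_cancel₀ h0.ne'] at h2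
          linarith
      exact ⟨hgx, by simp [entropy, max_eq_right h]⟩
    · have hr : 1 ≤ (c : ℝ) * l x := by exact_mod_cast h
      have hge : g x = (c * l x) * Real.log (c * l x) := by
        simp only [hg, hy, tsub_eq_zero_of_le h]
        simp
      have := Real.log_nonneg hr
      refine ⟨by rw [hge]; positivity, ?_⟩
      rw [hge, entropy, max_eq_left h, NNReal.coe_mul]
  have hgint : Integrable g μ₀ := ((hlint.const_mul _).add (hint.const_mul _)).add hsub
  have hgI : ∫ x, g x ∂μ₀ = c * Real.log c + c * I + ∫ x, ((1 - c * l x : ℝ≥0) : ℝ) ∂μ₀ := by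
    have hadd : Integrable (fun x => (c * Real.log c) * l x + c * (l x * Real.log (l x))) μ₀ :=
      (hlint.const_mul _).add (hint.const_mul _)
    rw [integral_congr_ae (Filter.Eventually.of_forall fun x => rfl), integral_add hadd hsub,
      integral_add (hlint.const_mul _) (hint.const_mul _), integral_const_mul, integral_const_mul,
      hl1, mul_one]
  calc ∫⁻ x, entropy (max (c * l x) 1) ∂μ₀
      ≤ ∫⁻ x, ENNReal.ofReal (g x) ∂μ₀ := lintegral_mono fun x => (hpt x).2
    _ = ENNReal.ofReal (∫ x, g x ∂μ₀) := (ofReal_integral_eq_lintegral_ofReal hgint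
        (Filter.Eventually.of_forall fun x => (hpt x).1)).symm
    _ = _ := by
      rw [hgI, ENNReal.ofReal_add (by positivity) (integral_nonneg fun _ => NNReal.coe_nonneg _),
        ENNReal.ofReal_add (by positivity) (by positivity),
        ofReal_integral_eq_lintegral_ofReal hsub
          (Filter.Eventually.of_forall fun _ => NNReal.coe_nonneg _), mul_comm (c : ℝ) I,
        ENNReal.ofReal_mul hI]
      simp [entropy]

/-- The Bhattacharyya coefficient of two distinct laws is less than one. -/
theorem lintegral_sqrt_lt_one (hl : Measurable l) (hone : ∫⁻ x, l x ∂μ₀ = 1)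
    (hI : 0 < ∫ x, (l x : ℝ) * Real.log (l x) ∂μ₀) :
    ∫⁻ x, NNReal.sqrt (l x) ∂μ₀ < 1 := by
  -- Arithmetic-geometric mean inequality, with equality only at a = 1. If the integral were at
  -- least one, equality would hold almost everywhere, so l = 1 and log l = 0.
  have hsq : ∀ a : ℝ≥0, NNReal.sqrt a ≤ (a + 1) / 2 := by
    intro a
    rw [le_div_iff₀ two_pos]
    rw [← NNReal.coe_le_coe]
    push_cast
    have := Real.sq_sqrt a.coe_nonneg
    nlinarith [sq_nonneg (Real.sqrt a - 1)]
  have hhalf : ∫⁻ x, ((l x + 1) / 2 : ℝ≥0) ∂μ₀ = 1 := by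
    have : ∀ x, (((l x + 1) / 2 : ℝ≥0) : ℝ≥0∞) = ((l x : ℝ≥0∞) + 1) * 2⁻¹ := by
      intro x
      rw [ENNReal.coe_div two_ne_zero, div_eq_mul_inv]
      simp
    simp_rw [this]
    rw [lintegral_mul_const _ (by fun_prop), lintegral_add_right _ (by fun_prop), hone]
    simp only [lintegral_const, measure_univ, mul_one]
    rw [one_add_one_eq_two]
    exact ENNReal.mul_inv_cancel two_ne_zero ENNReal.ofNat_ne_top
  by_contra hge
  rw [not_lt] at hge
  have hle : (fun x => ((NNReal.sqrt (l x) : ℝ≥0) : ℝ≥0∞)) ≤ᵐ[μ₀]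
      fun x => (((l x + 1) / 2 : ℝ≥0) : ℝ≥0∞) :=
    Filter.Eventually.of_forall fun x => ENNReal.coe_le_coe.2 (hsq (l x))
  have hfin : ∫⁻ x, NNReal.sqrt (l x) ∂μ₀ ≠ ∞ :=
    ne_top_of_le_ne_top (by rw [hhalf]; exact ENNReal.one_ne_top) (lintegral_mono_ae hle)
  have heq := ae_eq_of_ae_le_of_lintegral_le hle hfin (by fun_prop) (by rw [hhalf]; exact hge)
  refine hI.ne' (integral_eq_zero_of_ae ?_)
  filter_upwards [heq] with x hx
  rw [ENNReal.coe_inj] at hx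
  have hx' : Real.sqrt (l x) = ((l x : ℝ) + 1) / 2 := by
    have := congrArg ((↑) : ℝ≥0 → ℝ) hx
    push_cast at this
    exact this
  have h1 : Real.sqrt (l x) = 1 := by
    have := Real.sq_sqrt (l x).coe_nonneg
    have h0 : (Real.sqrt (l x) - 1) ^ 2 = 0 := by
      nlinarith
    linarith [pow_eq_zero_iff (two_ne_zero) |>.1 h0]
  have : (l x : ℝ) = 1 := by linarith
  simp [this]

end OneStep

/-! ### Drift of the CUSUM statistic, of its entropy and of its square root before the change -/

section Drift

variable {E : Type*} {mE : MeasurableSpace E} {μ₀ : Measure E} [IsProbabilityMeasure μ₀]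
  {l : E → ℝ≥0}

theorem measurable_cusum_pi (hl : Measurable l) (n : ℕ) : Measurable (cusum l n) :=
  (measurable_cusum hl n).mono (past_le le_rfl n) le_rfl

theorem setLIntegral_cusum_succ (hl : Measurable l) (hone : ∫⁻ x, l x ∂μ₀ = 1) {n : ℕ}
    {A : Set (ℕ → E)} (hA : MeasurableSet[past mE n] A) :
    ∫⁻ ω in A, cusum l (n + 1) ω ∂(Measure.infinitePi fun _ => μ₀)
      = ∫⁻ ω in A, (max (cusum l n ω) 1 : ℝ≥0) ∂(Measure.infinitePi fun _ => μ₀) := by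
  have h := setLIntegral_apply_eval (fun _ => μ₀) (measurable_cusum hl n) hA
    (H := fun v x => ((max v 1 * l x : ℝ≥0) : ℝ≥0∞))
    (((measurable_fst.max measurable_const).mul
      (hl.comp measurable_snd)).coe_nnreal_ennreal)
  refine h.trans (lintegral_congr fun ω => ?_)
  simp_rw [ENNReal.coe_mul]
  rw [lintegral_const_mul _ (by fun_prop), hone, mul_one]

theorem lintegral_max_cusum_ne_top (hl : Measurable l) (hone : ∫⁻ x, l x ∂μ₀ = 1) (n : ℕ) :
    ∫⁻ ω, (max (cusum l n ω) 1 : ℝ≥0) ∂(Measure.infinitePi fun _ => μ₀) ≠ ∞ := by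
  induction n with
  | zero => simp [cusum]
  | succ n ih =>
    have h := setLIntegral_cusum_succ hl hone (n := n) MeasurableSet.univ
    simp only [setLIntegral_univ] at h
    have hle : ∫⁻ ω, (max (cusum l (n + 1) ω) 1 : ℝ≥0) ∂(Measure.infinitePi fun _ => μ₀)
        ≤ ∫⁻ ω, ((cusum l (n + 1) ω : ℝ≥0∞) + 1) ∂(Measure.infinitePi fun _ => μ₀) :=
      lintegral_mono fun ω => by
        have : max (cusum l (n + 1) ω) 1 ≤ cusum l (n + 1) ω + 1 :=
          max_le (le_add_of_nonneg_right zero_le_one) (le_add_of_nonneg_left zero_le)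
        refine (ENNReal.coe_le_coe.2 this).trans (le_of_eq ?_)
        rw [ENNReal.coe_add, ENNReal.coe_one]
    refine ne_top_of_le_ne_top ?_ hle
    rw [lintegral_add_right _ measurable_const, h]
    simpa using ih

theorem setLIntegral_entropy_succ_le (hl : Measurable l) (hone : ∫⁻ x, l x ∂μ₀ = 1)
    (hint : Integrable (fun x => (l x : ℝ) * Real.log (l x)) μ₀)
    (hI : 0 ≤ ∫ x, (l x : ℝ) * Real.log (l x) ∂μ₀) {n : ℕ}
    {A : Set (ℕ → E)} (hA : MeasurableSet[past mE n] A) :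
    ∫⁻ ω in A, entropy (max (cusum l (n + 1) ω) 1) ∂(Measure.infinitePi fun _ => μ₀)
      ≤ ∫⁻ ω in A, entropy (max (cusum l n ω) 1) ∂(Measure.infinitePi fun _ => μ₀)
        + ENNReal.ofReal (∫ x, (l x : ℝ) * Real.log (l x) ∂μ₀)
          * ∫⁻ ω in A, (max (cusum l n ω) 1 : ℝ≥0) ∂(Measure.infinitePi fun _ => μ₀)
        + ∫⁻ ω in A, (1 - cusum l (n + 1) ω : ℝ≥0) ∂(Measure.infinitePi fun _ => μ₀) := by
  have hlx : Measurable fun p : ℝ≥0 × E => max p.1 1 * l p.2 :=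
    (measurable_fst.max measurable_const).mul (hl.comp measurable_snd)
  have h1 := setLIntegral_apply_eval (fun _ => μ₀) (measurable_cusum hl n) hA
    (H := fun v x => entropy (max (max v 1 * l x) 1))
    (measurable_entropy.comp (hlx.max measurable_const))
  have h2 := setLIntegral_apply_eval (fun _ => μ₀) (measurable_cusum hl n) hA
    (H := fun v x => ((1 - max v 1 * l x : ℝ≥0) : ℝ≥0∞))
    (measurable_const.sub hlx).coe_nnreal_ennreal
  have hVm := measurable_cusum_pi hl n
  have hMm : Measurable fun ω => max (cusum l n ω) 1 := hVm.max measurable_const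
  have e1 : ∫⁻ ω in A, entropy (max (cusum l (n + 1) ω) 1) ∂(Measure.infinitePi fun _ => μ₀)
      = ∫⁻ ω in A, ∫⁻ x, entropy (max (max (cusum l n ω) 1 * l x) 1) ∂μ₀
        ∂(Measure.infinitePi fun _ => μ₀) := h1
  have e2 : ∫⁻ ω in A, (1 - cusum l (n + 1) ω : ℝ≥0) ∂(Measure.infinitePi fun _ => μ₀)
      = ∫⁻ ω in A, ∫⁻ x, (1 - max (cusum l n ω) 1 * l x : ℝ≥0) ∂μ₀
        ∂(Measure.infinitePi fun _ => μ₀) := h2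
  have hEm : Measurable fun ω => entropy (max (cusum l n ω) 1) := measurable_entropy.comp hMm
  have hsm : Measurable fun ω => entropy (max (cusum l n ω) 1)
      + ENNReal.ofReal (∫ x, (l x : ℝ) * Real.log (l x) ∂μ₀)
        * ((max (cusum l n ω) 1 : ℝ≥0) : ℝ≥0∞) :=
    hEm.add (hMm.coe_nnreal_ennreal.const_mul _)
  rw [e1, e2, ← lintegral_const_mul _ hMm.coe_nnreal_ennreal,
    ← lintegral_add_left hEm,
    ← lintegral_add_left hsm]
  exact lintegral_mono fun ω => lintegral_entropy_le hl hone hint hI (le_max_right _ _)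

theorem lintegral_entropy_cusum_ne_top (hl : Measurable l) (hone : ∫⁻ x, l x ∂μ₀ = 1)
    (hint : Integrable (fun x => (l x : ℝ) * Real.log (l x)) μ₀)
    (hI : 0 ≤ ∫ x, (l x : ℝ) * Real.log (l x) ∂μ₀) (n : ℕ) :
    ∫⁻ ω, entropy (max (cusum l n ω) 1) ∂(Measure.infinitePi fun _ => μ₀) ≠ ∞ := by
  induction n with
  | zero => simp [cusum, entropy]
  | succ n ih =>
    have h := setLIntegral_entropy_succ_le hl hone hint hI (n := n) MeasurableSet.univ
    simp only [setLIntegral_univ] at h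
    refine ne_top_of_le_ne_top ?_ h
    refine ENNReal.add_ne_top.2 ⟨ENNReal.add_ne_top.2 ⟨ih, ENNReal.mul_ne_top ENNReal.ofReal_ne_top
      (lintegral_max_cusum_ne_top hl hone n)⟩, ?_⟩
    refine ne_top_of_le_ne_top ENNReal.one_ne_top
      ((lintegral_mono (g := fun _ => 1) fun ω => ?_).trans (by simp))
    exact ENNReal.coe_le_coe.2 (tsub_le_self (a := (1 : ℝ≥0)))

variable {A : ℕ → Set (ℕ → E)}

/-- Given the past, V_{n+1} has mean max(V_n, 1), so max(V, 1) gains exactly the mean of (1 -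
V_{n+1})⁺ in each step that is run. -/
theorem lintegral_stopped_max_cusum (hl : Measurable l) (hone : ∫⁻ x, l x ∂μ₀ = 1)
    (hA : ∀ n, MeasurableSet[past mE n] (A n)) (hanti : Antitone A) (N : ℕ) :
    ∫⁻ ω, (max (stopped A (cusum l) N ω) 1 : ℝ≥0) ∂(Measure.infinitePi fun _ => μ₀)
      = 1 + ∑ n ∈ Finset.range N, ∫⁻ ω in A n, (1 - cusum l (n + 1) ω : ℝ≥0)
          ∂(Measure.infinitePi fun _ => μ₀) := by
  set P := Measure.infinitePi fun _ : ℕ => μ₀ with hP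
  have hA' : ∀ n, MeasurableSet (A n) := fun n => past_le le_rfl n _ (hA n)
  induction N with
  | zero => simp [stopped, cusum]
  | succ n ih =>
    have h := lintegral_stopped_succ P hA' hanti (cusum l)
      (fun v => ((max v 1 : ℝ≥0) : ℝ≥0∞)) n
    have hs : ∫⁻ ω in A n, (max (cusum l (n + 1) ω) 1 : ℝ≥0) ∂P
        = ∫⁻ ω in A n, (max (cusum l n ω) 1 : ℝ≥0) ∂P
          + ∫⁻ ω in A n, (1 - cusum l (n + 1) ω : ℝ≥0) ∂P := by
      rw [← setLIntegral_cusum_succ hl hone (hA n),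
        ← lintegral_add_left (measurable_cusum_pi hl (n + 1)).coe_nnreal_ennreal]
      refine lintegral_congr fun ω => ?_
      rw [← add_tsub_eq_max, ENNReal.coe_add]
    have hfin : ∫⁻ ω in A n, (max (cusum l n ω) 1 : ℝ≥0) ∂P ≠ ∞ :=
      ne_top_of_le_ne_top (lintegral_max_cusum_ne_top hl hone n) (setLIntegral_le_lintegral _ _)
    rw [hs, ih, add_left_comm, add_comm] at h
    rw [Finset.sum_range_succ, ← add_assoc]
    exact (ENNReal.add_right_inj hfin).1 h

theorem lintegral_entropy_stopped_le (hl : Measurable l) (hone : ∫⁻ x, l x ∂μ₀ = 1)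
    (hint : Integrable (fun x => (l x : ℝ) * Real.log (l x)) μ₀)
    (hI : 0 ≤ ∫ x, (l x : ℝ) * Real.log (l x) ∂μ₀)
    (hA : ∀ n, MeasurableSet[past mE n] (A n)) (hanti : Antitone A) (N : ℕ) :
    ∫⁻ ω, entropy (max (stopped A (cusum l) N ω) 1) ∂(Measure.infinitePi fun _ => μ₀)
      ≤ ENNReal.ofReal (∫ x, (l x : ℝ) * Real.log (l x) ∂μ₀)
          * ∑ n ∈ Finset.range N, ∫⁻ ω in A n, (max (cusum l n ω) 1 : ℝ≥0)
            ∂(Measure.infinitePi fun _ => μ₀)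
        + ∑ n ∈ Finset.range N, ∫⁻ ω in A n, (1 - cusum l (n + 1) ω : ℝ≥0)
          ∂(Measure.infinitePi fun _ => μ₀) := by
  set P := Measure.infinitePi fun _ : ℕ => μ₀ with hP
  have hA' : ∀ n, MeasurableSet (A n) := fun n => past_le le_rfl n _ (hA n)
  induction N with
  | zero => simp [stopped, cusum, entropy]
  | succ n ih =>
    have h := lintegral_stopped_succ P hA' hanti (cusum l) (fun v => entropy (max v 1)) n
    have hfin : ∫⁻ ω in A n, entropy (max (cusum l n ω) 1) ∂P ≠ ∞ :=
      ne_top_of_le_ne_top (lintegral_entropy_cusum_ne_top hl hone hint hI n)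
        (setLIntegral_le_lintegral _ _)
    have h2 := h.le.trans (add_le_add ih (setLIntegral_entropy_succ_le hl hone hint hI (hA n)))
    rw [Finset.sum_range_succ, Finset.sum_range_succ, mul_add]
    refine (ENNReal.add_le_add_iff_right hfin).1 (h2.trans (le_of_eq ?_))
    ring

/-- Over one step the mean of √V becomes ρ times that of √max(V, 1), while √max(V, 1) ≤ √V + (1 -
V)⁺. Summing over time, (1 - ρ) Σ E√max(V_n, 1) is at most the sum of the (1 - V_n)⁺, and √max(V, 1)
≥ 1. So the test cannot run long without accumulating (1 - V)⁺. -/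
theorem sum_measure_le (hl : Measurable l) (hone : ∫⁻ x, l x ∂μ₀ = 1)
    (hA : ∀ n, MeasurableSet[past mE n] (A n)) (hanti : Antitone A) (N : ℕ) :
    (1 - ∫⁻ x, NNReal.sqrt (l x) ∂μ₀)
        * ∑ n ∈ Finset.range N, (Measure.infinitePi fun _ => μ₀) (A n)
      ≤ ∑ n ∈ Finset.range N, ∫⁻ ω in A n, (1 - cusum l n ω : ℝ≥0)
          ∂(Measure.infinitePi fun _ => μ₀) := by
  set P := Measure.infinitePi fun _ : ℕ => μ₀ with hP
  set ρ := ∫⁻ x, NNReal.sqrt (l x) ∂μ₀ with hρ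
  set c : ℕ → ℝ≥0∞ := fun n => ∫⁻ ω in A n, NNReal.sqrt (cusum l n ω) ∂P with hc
  set q : ℕ → ℝ≥0∞ := fun n => ∫⁻ ω in A n, NNReal.sqrt (max (cusum l n ω) 1) ∂P with hq
  set D : ℕ → ℝ≥0∞ := fun n => ∫⁻ ω in A n, (1 - cusum l n ω : ℝ≥0) ∂P with hD
  have hVm := measurable_cusum_pi hl
  have hqc : ∀ n, q n ≤ c n + D n := by
    intro n
    simp only [hq, hc, hD]
    rw [← lintegral_add_left (by have := hVm n; fun_prop)]
    refine lintegral_mono fun ω => ?_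
    have : NNReal.sqrt (max (cusum l n ω) 1)
        ≤ NNReal.sqrt (cusum l n ω) + (1 - cusum l n ω) := by
      generalize cusum l n ω = v
      rcases le_total v 1 with h | h
      · rw [max_eq_right h, NNReal.sqrt_one, ← tsub_le_iff_left]
        refine tsub_le_tsub_left ?_ 1
        rw [NNReal.le_sqrt_iff_sq_le]
        simpa [sq] using mul_le_of_le_one_left' h
      · simp [max_eq_left h]
    refine (ENNReal.coe_le_coe.2 this).trans (le_of_eq ?_)
    rw [ENNReal.coe_add]
  have hcq : ∀ n, c (n + 1) ≤ ρ * q n := by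
    intro n
    refine (lintegral_mono_set (hanti n.le_succ)).trans (le_of_eq ?_)
    have h := setLIntegral_apply_eval (fun _ => μ₀) (measurable_cusum hl n) (hA n)
      (H := fun v x => ((NNReal.sqrt (max v 1 * l x) : ℝ≥0) : ℝ≥0∞))
      (by
        have : Measurable fun p : ℝ≥0 × E => max p.1 1 * l p.2 :=
          (measurable_fst.max measurable_const).mul (hl.comp measurable_snd)
        exact (NNReal.continuous_sqrt.measurable.comp this).coe_nnreal_ennreal)
    refine h.trans ?_
    simp only [hq]
    rw [← lintegral_const_mul _ (by have := hVm n; fun_prop)]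
    refine lintegral_congr fun ω => ?_
    simp_rw [NNReal.sqrt_mul, ENNReal.coe_mul]
    rw [lintegral_const_mul _ (by fun_prop), mul_comm]
  have hc0 : c 0 = 0 := by simp [hc, cusum]
  have hsum : ∑ n ∈ Finset.range N, c n ≤ ρ * ∑ n ∈ Finset.range N, q n := by
    cases N with
    | zero => simp
    | succ N =>
      rw [Finset.sum_range_succ', hc0, add_zero, Finset.mul_sum]
      exact (Finset.sum_le_sum fun n _ => hcq n).trans
        (Finset.sum_le_sum_of_subset (Finset.range_mono N.le_succ))
  have hqtop : ∀ n, q n ≠ ∞ := by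
    intro n
    refine ne_top_of_le_ne_top (lintegral_max_cusum_ne_top hl hone n)
      ((lintegral_mono fun ω => ?_).trans (setLIntegral_le_lintegral (A n) _))
    rw [ENNReal.coe_le_coe, NNReal.sqrt_le_iff_le_sq]
    exact le_self_pow₀ (le_max_right _ _) two_ne_zero
  have hPq : ∀ n, P (A n) ≤ q n := by
    intro n
    simp only [hq]
    rw [← setLIntegral_one]
    refine lintegral_mono fun ω => ?_
    simp
  have hmain : ∑ n ∈ Finset.range N, q n
      ≤ ρ * ∑ n ∈ Finset.range N, q n + ∑ n ∈ Finset.range N, D n := by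
    refine (Finset.sum_le_sum fun n _ => hqc n).trans ?_
    rw [Finset.sum_add_distrib]
    gcongr
  calc (1 - ρ) * ∑ n ∈ Finset.range N, P (A n)
      ≤ (1 - ρ) * ∑ n ∈ Finset.range N, q n := by
        gcongr with n
        exact hPq n
    _ = ∑ n ∈ Finset.range N, q n - ρ * ∑ n ∈ Finset.range N, q n := by
        rw [ENNReal.sub_mul fun _ _ => ENNReal.sum_ne_top.2 fun n _ => hqtop n, one_mul]
    _ ≤ _ := tsub_le_iff_left.2 hmain

/-- Index shift: the term at time 0 is at most one, and the events `A n` decrease. -/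
theorem sum_setLIntegral_one_sub_cusum_le (hanti : Antitone A) (N : ℕ) :
    ∑ n ∈ Finset.range N, ∫⁻ ω in A n, (1 - cusum l n ω : ℝ≥0)
        ∂(Measure.infinitePi fun _ => μ₀)
      ≤ 1 + ∑ n ∈ Finset.range N, ∫⁻ ω in A n, (1 - cusum l (n + 1) ω : ℝ≥0)
          ∂(Measure.infinitePi fun _ => μ₀) := by
  cases N with
  | zero => simp
  | succ N =>
    rw [Finset.sum_range_succ', add_comm]
    refine add_le_add ?_ ?_
    · simpa [cusum] using prob_le_one
    · refine (Finset.sum_le_sum fun n _ => lintegral_mono_set (hanti n.le_succ)).trans ?_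
      exact Finset.sum_le_sum_of_subset (Finset.range_mono N.le_succ)

/-- Jensen's inequality for w log w, through its tangent at `a`: (log a + 1) w ≤ w log w + a. -/
theorem log_le_of_entropy_le {Ω : Type*} {mΩ : MeasurableSpace Ω} (P : Measure Ω)
    [IsProbabilityMeasure P] {W : Ω → ℝ≥0} {a b : ℝ} (ha : 1 ≤ a) (hb : 0 ≤ b)
    (hW : ∫⁻ ω, (W ω : ℝ≥0∞) ∂P = ENNReal.ofReal a) (hW1 : ∀ ω, 1 ≤ W ω)
    (hent : ∫⁻ ω, entropy (W ω) ∂P ≤ ENNReal.ofReal (b * a)) : Real.log a ≤ b := by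
  have ha0 : 0 < a := by linarith
  have hla : 0 ≤ Real.log a := Real.log_nonneg ha
  have hpt : ∀ ω, ENNReal.ofReal (Real.log a + 1) * W ω
      ≤ entropy (W ω) + ENNReal.ofReal a := by
    intro ω
    have hw : (1 : ℝ) ≤ W ω := by exact_mod_cast hW1 ω
    have hw0 : (0 : ℝ) < W ω := by linarith
    rw [entropy, ← ENNReal.ofReal_add (mul_nonneg hw0.le (Real.log_nonneg hw)) ha0.le,
      ← ENNReal.ofReal_coe_nnreal, ← ENNReal.ofReal_mul (by positivity)]
    refine ENNReal.ofReal_le_ofReal ?_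
    have h := Real.log_le_sub_one_of_pos (div_pos ha0 hw0)
    rw [Real.log_div ha0.ne' hw0.ne'] at h
    have h2 := mul_le_mul_of_nonneg_left h hw0.le
    have h3 : (W ω : ℝ) * (a / W ω - 1) = a - W ω := by field_simp
    nlinarith
  have h := lintegral_mono (μ := P) hpt
  rw [lintegral_const_mul' _ _ ENNReal.ofReal_ne_top, hW, lintegral_add_right _ measurable_const,
    lintegral_const, measure_univ, mul_one, ← ENNReal.ofReal_mul (by positivity)] at h
  have h' := h.trans (add_le_add_left hent _)
  rw [← ENNReal.ofReal_add (by positivity) ha0.le,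
    ENNReal.ofReal_le_ofReal_iff (by positivity)] at h'
  have : (Real.log a + 1) * a ≤ (b + 1) * a := by linarith
  linarith [le_of_mul_le_mul_right this ha0]

end Drift

/-! ### The lower bound for sequences -/

section LowerBound

variable {E : Type*} {m mE : MeasurableSpace E} {μ₀ μ₁ : Measure E} [IsProbabilityMeasure μ₀]
  [IsProbabilityMeasure μ₁] {l : E → ℝ≥0}

/-- A sequential test, given by the events `A n` that it continues after time `n`, whose delay is
at most `d` cannot run longer than an exponential in `d` on average. -/
theorem log_le_of_delay_le (hm : m ≤ mE) (hl : Measurable[m] l)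
    (hμ : ∀ B, MeasurableSet[m] B → μ₁ B = ∫⁻ x in B, l x ∂μ₀)
    (hint : Integrable (fun x => Real.log (l x)) μ₁) (hI : 0 < ∫ x, Real.log (l x) ∂μ₁)
    {A : ℕ → Set (ℕ → E)} (hA : ∀ n, MeasurableSet[past m n] (A n)) (hanti : Antitone A)
    {d : ℝ} (hd0 : 0 ≤ d)
    (hd : ∀ N k, ∀ w : (ℕ → E) → ℝ≥0∞, Measurable[past m k] w →
      ∑ n ∈ Finset.Ico k N, ∫⁻ ω in A n, w ω ∂(changeSeq μ₀ μ₁ k)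
        ≤ ENNReal.ofReal d * ∫⁻ ω, w ω ∂(changeSeq μ₀ μ₁ k))
    {γ : ℝ} (hγ : 1 ≤ γ)
    (harl : ENNReal.ofReal γ ≤ ∑' n, (Measure.infinitePi fun _ => μ₀) (A n)) :
    Real.log γ ≤ (∫ x, Real.log (l x) ∂μ₁) * d + 1
      - Real.log (1 - ∫⁻ x, NNReal.sqrt (l x) ∂μ₀).toReal := by
  have hlE : Measurable l := hl.mono hm le_rfl
  have hAE : ∀ n, MeasurableSet[past mE n] (A n) := fun n => past_mono_left hm n _ (hA n)
  have hone := lintegral_density_eq_one hμ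
  have hlog : Measurable[m] fun x => Real.log (l x) :=
    Real.measurable_log.comp hl.coe_nnreal_real
  have hint' := integrable_mul_of_trim hm hl hμ hlog hint
  have hI' := integral_mul_of_trim hm hl hμ hlog
  set I := ∫ x, Real.log (l x) ∂μ₁ with hIdef
  have hρ := lintegral_sqrt_lt_one hlE hone (hI'.symm ▸ hI)
  set ρ := ∫⁻ x, NNReal.sqrt (l x) ∂μ₀ with hρdef
  have hr : 0 < (1 - ρ).toReal :=
    ENNReal.toReal_pos (tsub_pos_of_lt hρ).ne' (ne_top_of_le_ne_top ENNReal.one_ne_top tsub_le_self)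
  have hrtop : 1 - ρ ≠ ∞ := ne_top_of_le_ne_top ENNReal.one_ne_top tsub_le_self
  set P := Measure.infinitePi fun _ : ℕ => μ₀ with hP
  have hN : ∀ N, (1 - ρ) * ∑ n ∈ Finset.range N, P (A n)
      ≤ ENNReal.ofReal (Real.exp (I * d + 1)) := by
    intro N
    set J := ∑ n ∈ Finset.range N, ∫⁻ ω in A n, (1 - cusum l (n + 1) ω : ℝ≥0) ∂P with hJ
    have hJtop : 1 + J ≠ ∞ := by
      refine ENNReal.add_ne_top.2 ⟨ENNReal.one_ne_top, ENNReal.sum_ne_top.2 fun n _ => ?_⟩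
      refine ne_top_of_le_ne_top ENNReal.one_ne_top
        ((lintegral_mono (g := fun _ => 1) fun ω => ?_).trans (by simpa using prob_le_one))
      exact ENNReal.coe_le_coe.2 (tsub_le_self (a := (1 : ℝ≥0)))
    -- By `lintegral_stopped_max_cusum`, `a` is the mean of max(V, 1) at the stopping time truncated
    -- at `N`.
    set a := (1 + J).toReal with ha
    have hofa : ENNReal.ofReal a = 1 + J := ENNReal.ofReal_toReal hJtop
    have ha1 : 1 ≤ a := by
      rw [← ENNReal.ofReal_le_ofReal_iff (by positivity), hofa, ENNReal.ofReal_one]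
      exact le_self_add
    have hD := sum_setLIntegral_one_sub_cusum_le (μ₀ := μ₀) (l := l) hanti N
    have hM := sum_setLIntegral_max_cusum_le hm hl hμ hA hanti (hd N)
    have hent := lintegral_entropy_stopped_le hlE hone hint' (by rw [hI']; exact hI.le) hAE hanti N
    rw [hI'] at hent
    have hent' : ∫⁻ ω, entropy (max (stopped A (cusum l) N ω) 1) ∂P
        ≤ ENNReal.ofReal ((I * d + 1) * a) := by
      refine hent.trans ?_
      rw [ENNReal.ofReal_mul (by positivity), ENNReal.ofReal_add (by positivity) zero_le_one,
        ENNReal.ofReal_mul hI.le, hofa, add_mul, ENNReal.ofReal_one, one_mul, mul_assoc]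
      refine add_le_add ?_ le_add_self
      gcongr
      refine hM.trans ?_
      gcongr
    have hloga := log_le_of_entropy_le P ha1 (by positivity)
      ((lintegral_stopped_max_cusum hlE hone hAE hanti N).trans hofa.symm)
      (fun ω => le_max_right _ _) hent'
    refine (sum_measure_le hlE hone hAE hanti N).trans (hD.trans ?_)
    rw [← hofa]
    refine ENNReal.ofReal_le_ofReal ?_
    rwa [← Real.log_le_iff_le_exp (by linarith)]
  have hsup : (1 - ρ) * ∑' n, P (A n) ≤ ENNReal.ofReal (Real.exp (I * d + 1)) := by
    rw [ENNReal.tsum_eq_iSup_nat, ENNReal.mul_iSup]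
    exact iSup_le hN
  have hfin : ENNReal.ofReal ((1 - ρ).toReal * γ) ≤ ENNReal.ofReal (Real.exp (I * d + 1)) := by
    rw [ENNReal.ofReal_mul hr.le, ENNReal.ofReal_toReal hrtop]
    refine le_trans ?_ hsup
    gcongr
  rw [ENNReal.ofReal_le_ofReal_iff (Real.exp_nonneg _),
    ← Real.log_le_iff_le_exp (by positivity), Real.log_mul hr.ne' (by positivity)] at hfin
  linarith

end LowerBound

/-! ### A potential for random walks with positive drift -/

section Potential

/-- Convexity of z ↦ ((a - z)⁺)²: its graph lies above the tangent at `y`. -/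
theorem sq_posPart_tangent (a y z : ℝ) :
    (max (a - y) 0) ^ 2 - 2 * max (a - y) 0 * (z - y) ≤ (max (a - z) 0) ^ 2 := by
  rcases le_total (a - y) 0 with h | h
  · rw [max_eq_right h]
    nlinarith [sq_nonneg (max (a - z) 0)]
  · rw [max_eq_left h]
    rcases le_total (a - z) 0 with h' | h'
    · rw [max_eq_right h']
      nlinarith
    · rw [max_eq_left h']
      nlinarith [sq_nonneg (z - y)]

variable {E : Type*} {mE : MeasurableSpace E} {μ : Measure E} [IsProbabilityMeasure μ] {X : E → ℝ}

/-- A potential for the distance of a random walk with positive drift from a level, which is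
linear up to a constant and loses at least the drift in every step before the level is passed. -/
theorem exists_potential (hX : MemLp X 2 μ) (hI : 0 < ∫ x, X x ∂μ) :
    ∃ (h : ℝ → ℝ) (C : ℝ), Measurable h ∧ (∀ y, 0 ≤ h y) ∧ (∀ y, 0 < y → h y ≤ y + C) ∧
      ∀ y, 0 < y → ∫⁻ x, ENNReal.ofReal (h (y - X x)) ∂μ + ENNReal.ofReal (∫ x, X x ∂μ)
        ≤ ENNReal.ofReal (h y) := by
  set I := ∫ x, X x ∂μ with hIdef
  set K := ∫ x, X x ^ 2 ∂μ with hK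
  have hK0 : 0 ≤ K := integral_nonneg fun _ => sq_nonneg _
  have hXi : Integrable X μ := hX.integrable one_le_two
  have hX2 : Integrable (fun x => X x ^ 2) μ := hX.integrable_sq
  -- Since (u - c)⁺ ≤ u²/(4c), this choice makes the mean overshoot below -c at most K/(4c) ≤ I/2
  -- from any positive distance.
  set c := (K + 1) / (2 * I) with hc
  have hc0 : 0 < c := by positivity
  have hpm : ∀ z : ℝ, MemLp (fun x => max (X x - c - z) 0) 2 μ := fun z =>
    ((hX.sub (memLp_const c)).sub (memLp_const z)).pos_part
  have hp1 : ∀ z : ℝ, Integrable (fun x => max (X x - c - z) 0) μ := fun z =>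
    (hpm z).integrable one_le_two
  have hp2 : ∀ z : ℝ, Integrable (fun x => (max (X x - c - z) 0) ^ 2) μ := fun z =>
    (hpm z).integrable_sq
  set q : ℝ → ℝ := fun z => ∫ x, max (X x - c - z) 0 ∂μ with hq
  set g : ℝ → ℝ := fun z => ∫ x, (max (X x - c - z) 0) ^ 2 ∂μ with hg
  have hq0 : ∀ z, 0 ≤ q z := fun z => integral_nonneg fun _ => le_max_right _ _
  have hg0 : ∀ z, 0 ≤ g z := fun z => integral_nonneg fun _ => sq_nonneg _
  have hgK : ∀ z, -c ≤ z → g z ≤ K := by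
    intro z hz
    refine integral_mono (hp2 z) hX2 fun x => ?_
    simp only
    rcases le_total (X x - c - z) 0 with h | h
    · rw [max_eq_right h]
      simpa using sq_nonneg (X x)
    · rw [max_eq_left h]
      exact pow_le_pow_left₀ h (by linarith) 2
  have hqI : ∀ z, 0 < z → q z ≤ I / 2 := by
    intro z hz
    have h1 : q z ≤ ∫ x, X x ^ 2 / (4 * c) ∂μ := by
      refine integral_mono (hp1 z) (hX2.div_const _) fun x => ?_
      refine max_le ?_ (by positivity)
      rw [le_div_iff₀ (by positivity)]
      nlinarith [sq_nonneg (X x - 2 * c)]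
    rw [integral_div, ← hK] at h1
    refine h1.trans ?_
    rw [div_le_iff₀ (by positivity), hc]
    field_simp
    linarith
  have hgtan : ∀ y z, g y - 2 * q y * (z - y) ≤ g z := by
    intro y z
    have h1 : ∫ x, ((max (X x - c - y) 0) ^ 2 - 2 * max (X x - c - y) 0 * (z - y)) ∂μ ≤ g z :=
      integral_mono ((hp2 y).sub (((hp1 y).const_mul 2).mul_const _)) (hp2 z)
        fun x => sq_posPart_tangent _ _ _
    rwa [integral_sub (hp2 y) (((hp1 y).const_mul 2).mul_const _), integral_mul_const,
      integral_const_mul] at h1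
  have hganti : Antitone g := by
    intro y z hyz
    refine integral_mono (hp2 z) (hp2 y) fun x => ?_
    exact pow_le_pow_left₀ (le_max_right _ _) (max_le_max_right 0 (by linarith)) 2
  -- Cutting the distance off at -c costs `q y` of the drift. The concave correction -g/I recovers
  -- it: Φ has a supporting line of slope 1 + 2q/I at y, the truncated step has mean q - I, and (1 +
  -- 2q/I)(q - I) ≤ -I as soon as q ≤ I/2.
  set Φ : ℝ → ℝ := fun z => z - g z / I with hΦ
  have hΦmono : Monotone Φ := by
    intro y z hyz
    simp only [hΦ]
    have := div_le_div_of_nonneg_right (hganti hyz) hI.le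
    linarith
  -- On [-c, ∞) one has g ≤ K, so Φ ≥ -c - K/I there; the added constant makes the potential
  -- nonnegative.
  refine ⟨fun y => Φ (max y (-c)) + (c + K / I), c + K / I, ?_, ?_, ?_, ?_⟩
  · exact (hΦmono.measurable.comp (measurable_id.max measurable_const)).add_const _
  · intro y
    simp only [hΦ]
    have h1 := div_le_div_of_nonneg_right (hgK (max y (-c)) (le_max_right _ _)) hI.le
    have h2 := le_max_right y (-c)
    linarith
  · intro y hy
    simp only [hΦ]
    rw [max_eq_left (by linarith)]
    have := div_nonneg (hg0 y) hI.le
    linarith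
  · intro y hy
    have hyc : max y (-c) = y := max_eq_left (by linarith)
    simp only [hyc]
    set U : E → ℝ := fun x => (Φ y + (c + K / I))
      + (1 + 2 * q y / I) * (max (X x - c - y) 0 - X x) with hU
    have hdiff : Integrable (fun x => max (X x - c - y) 0 - X x) μ := (hp1 y).sub hXi
    have hUint : Integrable U μ :=
      (integrable_const _).add (hdiff.const_mul _)
    have hUI : ∫ x, U x ∂μ = (Φ y + (c + K / I)) + (1 + 2 * q y / I) * (q y - I) := by
      rw [hU, integral_add (integrable_const _) (hdiff.const_mul _), integral_const_mul,
        integral_sub (hp1 y) hXi]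
      simp [hq, hIdef]
    have hpt : ∀ x, Φ (max (y - X x) (-c)) + (c + K / I) ≤ U x := by
      intro x
      have hz : max (y - X x) (-c) - y = max (X x - c - y) 0 - X x := by
        rcases le_total (y - X x) (-c) with h | h
        · rw [max_eq_right h, max_eq_left (by linarith)]
          ring
        · rw [max_eq_left h, max_eq_right (by linarith)]
          ring
      have ht := hgtan y (max (y - X x) (-c))
      simp only [hU, hΦ]
      rw [← hz]
      have := div_le_div_of_nonneg_right ht hI.le
      have e : (g y - 2 * q y * (max (y - X x) (-c) - y)) / I
          = g y / I - 2 * q y / I * (max (y - X x) (-c) - y) := by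
        field_simp
      rw [e] at this
      linarith
    have hnn : ∀ x, 0 ≤ U x := by
      intro x
      refine le_trans ?_ (hpt x)
      simp only [hΦ]
      have h1 := div_le_div_of_nonneg_right (hgK (max (y - X x) (-c)) (le_max_right _ _)) hI.le
      have h2 := le_max_right (y - X x) (-c)
      linarith
    have hdrift : ∫ x, U x ∂μ ≤ Φ y + (c + K / I) - I := by
      rw [hUI]
      have h1 := hqI y hy
      have h2 := hq0 y
      have h3 : (1 + 2 * q y / I) * (q y - I) = -I - q y * (1 - 2 * q y / I) := by
        field_simp
        ring
      have h4 : 0 ≤ 1 - 2 * q y / I := by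
        rw [sub_nonneg, div_le_one hI]
        linarith
      have := mul_nonneg h2 h4
      linarith
    have hU0 : 0 ≤ ∫ x, U x ∂μ := integral_nonneg hnn
    calc ∫⁻ x, ENNReal.ofReal (Φ (max (y - X x) (-c)) + (c + K / I)) ∂μ + ENNReal.ofReal I
        ≤ ∫⁻ x, ENNReal.ofReal (U x) ∂μ + ENNReal.ofReal I := by
          gcongr with x
          exact hpt x
      _ = ENNReal.ofReal (∫ x, U x ∂μ + I) := by
          rw [← ofReal_integral_eq_lintegral_ofReal hUint (Filter.Eventually.of_forall hnn),
            ENNReal.ofReal_add hU0 hI.le]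
      _ ≤ _ := ENNReal.ofReal_le_ofReal (by linarith)

end Potential

/-! ### The CUSUM test: run length and delay -/

section UpperBound

variable {E : Type*}

/-- The event that the CUSUM statistic stays below `B` up to time `n`. -/
def below (l : E → ℝ≥0) (B : ℝ≥0) (n : ℕ) : Set (ℕ → E) :=
  {ω | ∀ j ≤ n, cusum l j ω < B}

theorem antitone_below (l : E → ℝ≥0) (B : ℝ≥0) : Antitone (below l B) :=
  fun _ _ hij _ hω k hk => hω k (hk.trans hij)

theorem measurableSet_below {m : MeasurableSpace E} {l : E → ℝ≥0} (hl : Measurable[m] l) (B : ℝ≥0)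
    (n : ℕ) : MeasurableSet[past m n] (below l B n) := by
  have : below l B n = ⋂ j, ⋂ (_ : j ≤ n), cusum l j ⁻¹' Set.Iio B := by
    ext ω
    simp [below]
  rw [this]
  exact MeasurableSet.iInter fun j => MeasurableSet.iInter fun hj =>
    past_mono m hj _ (measurable_cusum hl j measurableSet_Iio)

theorem le_stopped_of_notMem_below (l : E → ℝ≥0) (B : ℝ≥0) {n : ℕ} {ω : ℕ → E}
    (h : ω ∉ below l B n) : B ≤ stopped (below l B) (cusum l) n ω := by
  induction n with
  | zero => simpa [below, stopped] using h
  | succ n ih =>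
    by_cases hn : ω ∈ below l B n
    · rw [stopped, if_pos hn]
      by_contra hlt
      refine h fun j hj => ?_
      rcases Nat.le_succ_iff.1 hj with hj | rfl
      exacts [hn j hj, not_le.1 hlt]
    · rw [stopped, if_neg hn]
      exact ih hn

variable {mE : MeasurableSpace E} {μ₀ μ₁ : Measure E} [IsProbabilityMeasure μ₀]
  [IsProbabilityMeasure μ₁] {l : E → ℝ≥0}

/-- The mean of V_{n+1} given the past is max(V_n, 1) ≤ V_n + 1, so V gains at most one per step. -/
theorem lintegral_stopped_cusum_le (hl : Measurable l) (hone : ∫⁻ x, l x ∂μ₀ = 1)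
    {A : ℕ → Set (ℕ → E)} (hA : ∀ n, MeasurableSet[past mE n] (A n)) (hanti : Antitone A) (N : ℕ) :
    ∫⁻ ω, (stopped A (cusum l) N ω : ℝ≥0) ∂(Measure.infinitePi fun _ => μ₀)
      ≤ ∑ n ∈ Finset.range N, (Measure.infinitePi fun _ => μ₀) (A n) := by
  set P := Measure.infinitePi fun _ : ℕ => μ₀ with hP
  have hA' : ∀ n, MeasurableSet (A n) := fun n => past_le le_rfl n _ (hA n)
  induction N with
  | zero => simp [stopped, cusum]
  | succ n ih =>
    have h := lintegral_stopped_succ P hA' hanti (cusum l) (fun v => (v : ℝ≥0∞)) n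
    have hle : ∫⁻ ω in A n, (max (cusum l n ω) 1 : ℝ≥0) ∂P
        ≤ ∫⁻ ω in A n, cusum l n ω ∂P + P (A n) := by
      rw [← setLIntegral_one, ← lintegral_add_right _ measurable_const]
      refine lintegral_mono fun ω => ?_
      have : max (cusum l n ω) 1 ≤ cusum l n ω + 1 :=
        max_le (le_add_of_nonneg_right zero_le_one) (le_add_of_nonneg_left zero_le)
      refine (ENNReal.coe_le_coe.2 this).trans (le_of_eq ?_)
      rw [ENNReal.coe_add, ENNReal.coe_one]
    have hfin : ∫⁻ ω in A n, cusum l n ω ∂P ≠ ∞ := by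
      refine ne_top_of_le_ne_top (lintegral_max_cusum_ne_top hl hone n)
        ((lintegral_mono fun ω => ?_).trans (setLIntegral_le_lintegral (A n) _))
      exact ENNReal.coe_le_coe.2 (le_max_left _ _)
    rw [setLIntegral_cusum_succ hl hone (hA n)] at h
    rw [Finset.sum_range_succ]
    refine (ENNReal.add_le_add_iff_right hfin).1 (h.le.trans ((add_le_add ih hle).trans ?_))
    exact le_of_eq (by ring)

/-- For `N ≥ B`, either the test is still running at time `N`, or the stopped statistic has reached
`B`. Each case contributes at most one run length, and finiteness of the stopping time is not
needed. -/
theorem le_two_mul_tsum_below (hl : Measurable l) (hone : ∫⁻ x, l x ∂μ₀ = 1) (B : ℝ≥0) :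
    (B : ℝ≥0∞) ≤ 2 * ∑' n, (Measure.infinitePi fun _ => μ₀) (below l B n) := by
  set P := Measure.infinitePi fun _ : ℕ => μ₀ with hP
  obtain ⟨N, hN⟩ := exists_nat_ge B
  have hsum : ∑ n ∈ Finset.range N, P (below l B n) ≤ ∑' n, P (below l B n) :=
    ENNReal.sum_le_tsum _
  have hmeas := past_le le_rfl N _ (measurableSet_below hl B N)
  have h1 : (B : ℝ≥0∞) * P (below l B N) ≤ ∑' n, P (below l B n) := by
    refine le_trans ?_ hsum
    calc (B : ℝ≥0∞) * P (below l B N) ≤ (N : ℝ≥0∞) * P (below l B N) := by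
          gcongr
          exact_mod_cast ENNReal.coe_le_coe.2 hN
      _ = ∑ n ∈ Finset.range N, P (below l B N) := by simp
      _ ≤ _ := Finset.sum_le_sum fun n hn =>
          measure_mono (antitone_below l B (Finset.mem_range.1 hn).le)
  have h2 : (B : ℝ≥0∞) * P (below l B N)ᶜ ≤ ∑' n, P (below l B n) := by
    refine le_trans ?_ ((lintegral_stopped_cusum_le hl hone (measurableSet_below hl B)
      (antitone_below l B) N).trans hsum)
    rw [← setLIntegral_const]
    refine le_trans (setLIntegral_mono' hmeas.compl fun ω hω => ?_) (setLIntegral_le_lintegral _ _)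
    exact ENNReal.coe_le_coe.2 (le_stopped_of_notMem_below l B hω)
  calc (B : ℝ≥0∞) = B * P (below l B N) + B * P (below l B N)ᶜ := by
        rw [← mul_add, measure_add_measure_compl hmeas, measure_univ, mul_one]
    _ ≤ _ := by
        rw [two_mul]
        exact add_le_add h1 h2

/-- The delay of the CUSUM test after a change at the index `k`, on any event of the past. -/
theorem exists_sum_below_le (hl : Measurable l) (hpos : ∀ᵐ x ∂μ₁, l x ≠ 0)
    (hX : MemLp (fun x => Real.log (l x)) 2 μ₁) (hI : 0 < ∫ x, Real.log (l x) ∂μ₁) :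
    ∃ C : ℝ, ∀ B : ℝ≥0, 1 < B → ∀ k N : ℕ, ∀ S : Set (ℕ → E), MeasurableSet[past mE k] S →
      ENNReal.ofReal (∫ x, Real.log (l x) ∂μ₁)
          * ∑ n ∈ Finset.Ico k N, changeSeq μ₀ μ₁ k (S ∩ below l B n)
        ≤ ENNReal.ofReal (Real.log B + C) * changeSeq μ₀ μ₁ k S := by
  obtain ⟨h, C, hm, h0, hC, hstep⟩ := exists_potential hX hI
  set I := ∫ x, Real.log (l x) ∂μ₁ with hIdef
  refine ⟨C, fun B hB k N S hS => ?_⟩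
  have hb : 0 < Real.log B := Real.log_pos (by exact_mod_cast hB)
  set b := Real.log B with hbdef
  -- The potential of the distance from log L to the threshold log B. The value ∞ at L = 0 makes the
  -- drift inequality trivial there.
  set H : ℝ≥0 → ℝ≥0∞ := fun L => if L = 0 then ∞ else ENNReal.ofReal (h (b - Real.log L)) with hH
  have hHm : Measurable H := by
    refine Measurable.ite (measurableSet_singleton 0) measurable_const ?_
    exact (hm.comp (measurable_const.sub
      (Real.measurable_log.comp measurable_coe_nnreal_real))).ennreal_ofReal
  have hHstep : ∀ L : ℝ≥0, L < B → ∫⁻ x, H (L * l x) ∂μ₁ + ENNReal.ofReal I ≤ H L := by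
    intro L hL
    rcases eq_or_ne L 0 with rfl | hL0
    · simp [hH]
    have hLr : (0 : ℝ) < L := by exact_mod_cast pos_iff_ne_zero.2 hL0
    have hy : 0 < b - Real.log L := sub_pos.2 (Real.log_lt_log hLr (by exact_mod_cast hL))
    refine le_trans (le_of_eq ?_) ((hstep _ hy).trans (le_of_eq (by simp [hH, hL0])))
    congr 1
    refine lintegral_congr_ae ?_
    filter_upwards [hpos] with x hx
    simp only [hH, mul_eq_zero, hL0, hx, or_self, if_false, NNReal.coe_mul]
    rw [Real.log_mul hLr.ne' (by exact_mod_cast hx), sub_sub]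
  set ν := changeSeq μ₀ μ₁ k with hν
  have hprob : ∀ j, IsProbabilityMeasure (if j < k then μ₀ else μ₁) := by
    intro j
    split_ifs <;> infer_instance
  have hSA : ∀ n, k ≤ n → MeasurableSet[past mE n] (S ∩ below l B n) := fun n hn =>
    (past_mono mE hn _ hS).inter (measurableSet_below hl B n)
  have hHlm : Measurable fun p : ℝ≥0 × E => H (p.1 * l p.2) :=
    hHm.comp (measurable_fst.mul (hl.comp measurable_snd))
  have hrec : ∀ n, k ≤ n → ∫⁻ ω in S ∩ below l B (n + 1), H (lr l k (n + 1) ω) ∂ν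
      + ENNReal.ofReal I * ν (S ∩ below l B n) ≤ ∫⁻ ω in S ∩ below l B n, H (lr l k n ω) ∂ν := by
    intro n hn
    have hmeas := past_le le_rfl n _ (hSA n hn)
    have hs := setLIntegral_apply_eval (fun j => if j < k then μ₀ else μ₁)
      (measurable_lr hl k n) (hSA n hn) (H := fun L x => H (L * l x)) hHlm
    simp only [if_neg hn.not_gt] at hs
    calc _ ≤ ∫⁻ ω in S ∩ below l B n, H (lr l k (n + 1) ω) ∂ν
          + ENNReal.ofReal I * ν (S ∩ below l B n) := by
          gcongr
          exact antitone_below l B n.le_succ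
      _ = ∫⁻ ω in S ∩ below l B n, ∫⁻ x, H (lr l k n ω * l x) ∂μ₁ ∂ν
          + ENNReal.ofReal I * ν (S ∩ below l B n) := by
          simp_rw [lr_succ l hn]
          congr 1
      _ = ∫⁻ ω in S ∩ below l B n,
            (∫⁻ x, H (lr l k n ω * l x) ∂μ₁ + ENNReal.ofReal I) ∂ν := by
          rw [lintegral_add_right _ measurable_const, setLIntegral_const]
      _ ≤ _ := by
          refine setLIntegral_mono' hmeas fun ω hω => hHstep _ ?_
          -- At the change itself the restarted ratio is 1 < B; later it is dominated by the CUSUM,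
          -- which is still below `B`.
          rcases hn.eq_or_lt with rfl | hlt
          · simpa [lr] using hB
          · exact (lr_le_cusum l hlt ω).trans_lt (hω.2 n le_rfl)
  -- Telescoping: each further step of the test uses up I of the potential, which starts at h(log B)
  -- ≤ log B + C.
  have htel : ∀ N, k ≤ N → ENNReal.ofReal I * ∑ n ∈ Finset.Ico k N, ν (S ∩ below l B n)
      + ∫⁻ ω in S ∩ below l B N, H (lr l k N ω) ∂ν
        ≤ ∫⁻ ω in S ∩ below l B k, H (lr l k k ω) ∂ν := by
    intro N hN
    induction N, hN using Nat.le_induction with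
    | base => simp
    | succ n hn ih =>
      refine le_trans ?_ ih
      rw [Finset.sum_Ico_succ_top hn, mul_add, add_assoc]
      gcongr
      rw [add_comm]
      exact hrec n hn
  have hstart : ∫⁻ ω in S ∩ below l B k, H (lr l k k ω) ∂ν ≤ ENNReal.ofReal (b + C) * ν S := by
    simp only [lr, Finset.Ico_self, Finset.prod_empty, setLIntegral_const]
    gcongr
    · simpa [hH] using ENNReal.ofReal_le_ofReal (hC b hb)
    · exact Set.inter_subset_left
  rcases le_total k N with hN | hN
  · exact le_self_add.trans ((htel N hN).trans hstart)
  · simp [Finset.Ico_eq_empty_of_le hN]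

end UpperBound

/-! ### Delays as sums of tail events -/

section Time

theorem toENNReal_sub_eq_tsum (t : ℕ∞) (k : ℕ) :
    ENat.toENNReal t - (k : ℝ≥0∞) = ∑' n : ℕ, if ((k + n : ℕ) : ℕ∞) < t then 1 else 0 := by
  induction t using ENat.recTopCoe with
  | top => simp
  | coe t =>
    rw [tsum_eq_sum (s := Finset.range (t - k))]
    · rw [Finset.sum_congr rfl fun n hn => if_pos ?_]
      · simp
      · rw [Nat.cast_lt]
        have := Finset.mem_range.1 hn
        omega
    · intro n hn
      rw [if_neg]
      rw [Nat.cast_lt]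
      have := mt Finset.mem_range.2 hn
      omega

/-- For κ = k + 1, the delay T - κ + 1 is T - k: `k` terms precede the change. -/
theorem toENNReal_add_one_sub (t : ℕ∞) (k : ℕ) :
    ENat.toENNReal t + 1 - ((k + 1 : ℕ) : ℝ≥0∞) = ENat.toENNReal t - (k : ℝ≥0∞) := by
  rw [Nat.cast_add, Nat.cast_one, add_comm (k : ℝ≥0∞), ← tsub_tsub,
    ENNReal.add_sub_cancel_right ENNReal.one_ne_top]

variable {Ω : Type*} {mΩ : MeasurableSpace Ω}

theorem measurable_toENNReal_sub {T : Ω → ℕ∞} (hT : ∀ n : ℕ, MeasurableSet {ω | (n : ℕ∞) < T ω})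
    (k : ℕ) : Measurable fun ω => ENat.toENNReal (T ω) - (k : ℝ≥0∞) := by
  simp_rw [toENNReal_sub_eq_tsum]
  exact Measurable.tsum fun n => Measurable.ite (hT _) measurable_const measurable_const

theorem lintegral_mul_toENNReal_sub (P : Measure Ω) {T : Ω → ℕ∞}
    (hT : ∀ n : ℕ, MeasurableSet {ω | (n : ℕ∞) < T ω}) {w : Ω → ℝ≥0∞} (hw : Measurable w) (k : ℕ) :
    ∫⁻ ω, w ω * (ENat.toENNReal (T ω) - (k : ℝ≥0∞)) ∂P
      = ∑' n, ∫⁻ ω in {ω | ((k + n : ℕ) : ℕ∞) < T ω}, w ω ∂P := by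
  simp_rw [toENNReal_sub_eq_tsum, ← ENNReal.tsum_mul_left]
  have hmeas : ∀ n : ℕ, Measurable fun ω => w ω * if ((k + n : ℕ) : ℕ∞) < T ω then 1 else 0 :=
    fun n => hw.mul (Measurable.ite (hT _) measurable_const measurable_const)
  rw [lintegral_tsum fun n => (hmeas n).aemeasurable]
  refine tsum_congr fun n => ?_
  rw [← lintegral_indicator (hT _)]
  refine lintegral_congr fun ω => ?_
  by_cases h : ((k + n : ℕ) : ℕ∞) < T ω
  · rw [if_pos h, mul_one, Set.indicator_of_mem (by exact h)]
  · rw [if_neg h, mul_zero, Set.indicator_of_notMem (by exact h)]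

end Time

/-! ### The likelihood ratio of one similarity network -/

section Network

variable {N : ℕ} (G : SimpleGraph (Fin N)) (S : Finset (Fin N)) (P₀ P₁ P₂ : Measure ℝ)

/-- The σ-algebra of a network of similarities that is seen on the edges in `U` only. -/
@[reducible]
def edgeAlgebra (U : Set (Sym2 (Fin N))) : MeasurableSpace (G.edgeSet → ℝ) :=
  coordAlgebra (fun _ => inferInstance) {e : G.edgeSet | (e : Sym2 (Fin N)) ∈ U}

theorem edgeAlgebra_le (U : Set (Sym2 (Fin N))) : edgeAlgebra G U ≤ MeasurableSpace.pi :=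
  iSup₂_le fun i _ => (measurable_pi_apply i).comap_le

theorem edgeAlgebra_univ : edgeAlgebra G Set.univ = MeasurableSpace.pi := by
  simp [edgeAlgebra, coordAlgebra, MeasurableSpace.pi]

theorem obsFiltration_eq_past (U : Set (Sym2 (Fin N))) (n : ℕ) :
    obsFiltration G U n = past (edgeAlgebra G U) n := by
  change (⨆ (k : ℕ) (_ : k < n) (e : G.edgeSet) (_ : (e : Sym2 (Fin N)) ∈ U),
    MeasurableSpace.comap (fun ω : Obs G => ω k e) inferInstance) = _
  simp only [past, edgeAlgebra, coordAlgebra, MeasurableSpace.comap_iSup,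
    MeasurableSpace.comap_comp, Set.mem_Iio, Set.mem_ofPred_eq]
  rfl

/-- The edges of `G` that are cut by `S`, as a finite set of edges. -/
noncomputable def cutFinset : Finset G.edgeSet :=
  (Set.toFinite {e : G.edgeSet | (e : Sym2 (Fin N)) ∈ cutEdges G S}).toFinset

theorem mem_cutFinset {e : G.edgeSet} :
    e ∈ cutFinset G S ↔ (e : Sym2 (Fin N)) ∈ cutEdges G S := by
  simp [cutFinset]

theorem card_cutFinset : (cutFinset G S).card = cut G S := by
  rw [cut, cutFinset, ← Set.ncard_eq_toFinset_card _]
  rw [← Set.ncard_image_of_injective _ Subtype.val_injective]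
  congr 1
  ext e
  constructor
  · rintro ⟨e, he, rfl⟩
    exact he
  · intro he
    exact ⟨⟨e, he.1⟩, he, rfl⟩

/-- The density of `P₁` with respect to `P₀`. -/
noncomputable def density (x : ℝ) : ℝ≥0 := (P₁.rnDeriv P₀ x).toNNReal

theorem measurable_density : Measurable (density P₀ P₁) :=
  (Measure.measurable_rnDeriv _ _).ennreal_toNNReal

/-- The likelihood ratio of one network of similarities. -/
noncomputable def edgeRatio (x : G.edgeSet → ℝ) : ℝ≥0 :=
  ∏ e ∈ cutFinset G S, density P₀ P₁ (x e)

theorem measurable_edgeRatio {U : Set (Sym2 (Fin N))} (hU : cutEdges G S ⊆ U) :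
    Measurable[edgeAlgebra G U] (edgeRatio G S P₀ P₁) := by
  refine Finset.measurable_prod _ fun e he => (measurable_density P₀ P₁).comp ?_
  refine measurable_iff_comap_le.2 (le_biSup (f := fun e : G.edgeSet =>
    MeasurableSpace.comap (fun x : G.edgeSet → ℝ => x e) inferInstance) ?_)
  exact hU ((mem_cutFinset G S).1 he)

theorem changeLaw_eq (k : ℕ) : changeLaw G S P₀ P₁ P₂ (k + 1)
    = changeSeq (Measure.infinitePi fun _ : G.edgeSet => P₀)
      (Measure.infinitePi (postLaw G S P₀ P₁ P₂)) k := by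
  unfold changeLaw changeSeq
  congr 1
  funext j
  simp only [Nat.add_lt_add_iff_right]
  split_ifs <;> rfl

theorem postLaw_of_mem_cutFinset {e : G.edgeSet} (he : e ∈ cutFinset G S) :
    postLaw G S P₀ P₁ P₂ e = P₁ := if_pos ((mem_cutFinset G S).1 he)

theorem measurableSet_lt_of_isStoppingTime {U : Set (Sym2 (Fin N))} {T : Obs G → WithTop ℕ}
    (hT : IsStoppingTime (obsFiltration G U) T) (n : ℕ) :
    MeasurableSet[past (edgeAlgebra G U) n] {ω | (n : ℕ∞) < T ω} := by
  have h := (hT n).compl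
  rw [obsFiltration_eq_past] at h
  convert h using 1
  ext ω
  exact (not_le (a := T ω)).symm

theorem cutEdges_subset_compl_insideEdges : cutEdges G S ⊆ (insideEdges G S)ᶜ := by
  rintro _ ⟨-, i, -, j, hj, rfl⟩ h
  exact hj (h.2 j (Sym2.mem_mk_right i j))

variable [IsProbabilityMeasure P₀] [IsProbabilityMeasure P₁] [IsProbabilityMeasure P₂]

variable {P₀ P₁} in
theorem setLIntegral_density (h : P₁ ≪ P₀) (B : Set ℝ) :
    ∫⁻ x in B, density P₀ P₁ x ∂P₀ = P₁ B := by
  rw [← Measure.setLIntegral_rnDeriv h]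
  refine lintegral_congr_ae (ae_restrict_of_ae ?_)
  filter_upwards [Measure.rnDeriv_lt_top P₁ P₀] with x hx
  exact ENNReal.coe_toNNReal hx.ne

instance (e : G.edgeSet) : IsProbabilityMeasure (postLaw G S P₀ P₁ P₂ e) := by
  unfold postLaw
  split_ifs <;> infer_instance

-- A visible edge that is not cut keeps the law `P₀`: either no inside edge is visible, or `P₂ =
-- P₀`. Only the cut edges contribute to the density.
variable {P₀ P₁ P₂} in
theorem infinitePi_postLaw_apply (h : P₁ ≪ P₀) {U : Set (Sym2 (Fin N))}
    (hU : P₂ = P₀ ∨ U ⊆ (insideEdges G S)ᶜ) (B : Set (G.edgeSet → ℝ))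
    (hB : MeasurableSet[edgeAlgebra G U] B) :
    Measure.infinitePi (postLaw G S P₀ P₁ P₂) B
      = ∫⁻ x in B, edgeRatio G S P₀ P₁ x ∂(Measure.infinitePi fun _ : G.edgeSet => P₀) := by
  classical
  have := Fintype.ofFinite G.edgeSet
  have hB' := edgeAlgebra_le G U _ hB
  have hd : Measurable fun x => (density P₀ P₁ x : ℝ≥0∞) :=
    (measurable_density P₀ P₁).coe_nnreal_ennreal
  have key := lintegral_infinitePi_eq_lintegral_mul_prod (m := fun _ : G.edgeSet => inferInstance)
    (fun _ => le_rfl) (fun _ => P₀) (postLaw G S P₀ P₁ P₂) Finset.univ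
    {e : G.edgeSet | (e : Sym2 (Fin N)) ∈ U} (by simp)
    (fun e x => if e ∈ cutFinset G S then (density P₀ P₁ x : ℝ≥0∞) else 1) ?_ ?_ ?_
    (f := B.indicator fun _ => 1) (measurable_const.indicator hB)
  · rw [lintegral_indicator hB', setLIntegral_one] at key
    rw [key, ← lintegral_indicator hB']
    refine lintegral_congr fun x => ?_
    by_cases hx : x ∈ B
    · simp only [Set.indicator_of_mem hx, one_mul, edgeRatio, ENNReal.ofNNReal_finsetProd]
      rw [Finset.prod_ite_mem, Finset.univ_inter]
    · simp [hx]
  · intro e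
    split_ifs
    exacts [hd, measurable_const]
  · intro e _
    split_ifs
    · rw [← setLIntegral_univ, setLIntegral_density h, measure_univ]
    · simp
  · intro e he A _
    by_cases hc : e ∈ cutFinset G S
    · simp only [if_pos hc]
      rw [postLaw_of_mem_cutFinset G S P₀ P₁ P₂ hc, setLIntegral_density h]
    · simp only [if_neg hc, setLIntegral_one]
      have hc' := mt (mem_cutFinset G S).2 hc
      rw [postLaw, if_neg hc']
      rcases hU with rfl | hU
      · simp
      · rw [if_neg (hU he)]

theorem map_eval_infinitePi_postLaw {e : G.edgeSet} (he : e ∈ cutFinset G S) :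
    MeasurePreserving (fun x : G.edgeSet → ℝ => x e)
      (Measure.infinitePi (postLaw G S P₀ P₁ P₂)) P₁ := by
  have := measurePreserving_eval_infinitePi (postLaw G S P₀ P₁ P₂) e
  rwa [postLaw_of_mem_cutFinset G S P₀ P₁ P₂ he] at this

variable {P₀ P₁}

theorem edgeRatio_ne_zero (h : P₁ ≪ P₀) :
    ∀ᵐ x ∂(Measure.infinitePi (postLaw G S P₀ P₁ P₂)), edgeRatio G S P₀ P₁ x ≠ 0 := by
  have hp : ∀ᵐ y ∂P₁, density P₀ P₁ y ≠ 0 := by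
    filter_upwards [Measure.rnDeriv_pos h, h (Measure.rnDeriv_lt_top P₁ P₀)] with y h1 h2
    exact (ENNReal.toNNReal_pos h1.ne' h2.ne).ne'
  have : ∀ᵐ x ∂(Measure.infinitePi (postLaw G S P₀ P₁ P₂)),
      ∀ e ∈ cutFinset G S, density P₀ P₁ (x e) ≠ 0 :=
    (Finset.eventually_all _).2 fun e he =>
      (map_eval_infinitePi_postLaw G S P₀ P₁ P₂ he).quasiMeasurePreserving.ae hp
  filter_upwards [this] with x hx
  exact Finset.prod_ne_zero_iff.2 hx

theorem log_edgeRatio (h : P₁ ≪ P₀) :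
    (fun x => Real.log (edgeRatio G S P₀ P₁ x))
      =ᵐ[Measure.infinitePi (postLaw G S P₀ P₁ P₂)]
        fun x => ∑ e ∈ cutFinset G S, llr P₁ P₀ (x e) := by
  filter_upwards [edgeRatio_ne_zero G S P₂ h] with x hx
  have hx' := Finset.prod_ne_zero_iff.1 hx
  rw [edgeRatio, NNReal.coe_prod, Real.log_prod fun e he => by exact_mod_cast hx' e he]
  rfl

theorem integrable_log_edgeRatio (h : P₁ ≪ P₀) (hint : Integrable (llr P₁ P₀) P₁) :
    Integrable (fun x => Real.log (edgeRatio G S P₀ P₁ x))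
      (Measure.infinitePi (postLaw G S P₀ P₁ P₂)) := by
  refine (integrable_congr (log_edgeRatio G S P₂ h)).2 (integrable_finsetSum _ fun e he => ?_)
  exact (map_eval_infinitePi_postLaw G S P₀ P₁ P₂ he).integrable_comp_of_integrable hint

theorem memLp_log_edgeRatio (h : P₁ ≪ P₀) (hint : MemLp (llr P₁ P₀) 2 P₁) :
    MemLp (fun x => Real.log (edgeRatio G S P₀ P₁ x)) 2
      (Measure.infinitePi (postLaw G S P₀ P₁ P₂)) := by
  refine (memLp_congr_ae (log_edgeRatio G S P₂ h)).2 (memLp_finsetSum _ fun e he => ?_)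
  exact hint.comp_measurePreserving (map_eval_infinitePi_postLaw G S P₀ P₁ P₂ he)

/-- The log-likelihood ratio is a sum over the cut edges, and each similarity has law `P₁` there, so
each contributes one divergence. -/
theorem integral_log_edgeRatio (h : P₁ ≪ P₀) (hint : Integrable (llr P₁ P₀) P₁) :
    ∫ x, Real.log (edgeRatio G S P₀ P₁ x) ∂(Measure.infinitePi (postLaw G S P₀ P₁ P₂))
      = cut G S * (klDiv P₁ P₀).toReal := by
  have hi : ∀ e ∈ cutFinset G S, Integrable (fun x : G.edgeSet → ℝ => llr P₁ P₀ (x e))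
      (Measure.infinitePi (postLaw G S P₀ P₁ P₂)) := fun e he =>
    (map_eval_infinitePi_postLaw G S P₀ P₁ P₂ he).integrable_comp_of_integrable hint
  rw [integral_congr_ae (log_edgeRatio G S P₂ h), integral_finsetSum _ hi]
  rw [Finset.sum_congr rfl fun e he => ?_, Finset.sum_const, card_cutFinset, nsmul_eq_mul]
  rw [toReal_klDiv_of_measure_eq h (by simp)]
  have hmp := map_eval_infinitePi_postLaw G S P₀ P₁ P₂ he
  rw [← hmp.map_eq, integral_map hmp.aemeasurable
    (by rw [hmp.map_eq]; exact (measurable_llr P₁ P₀).aestronglyMeasurable), hmp.map_eq]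

end Network

/-! ### Lower and upper bounds for the networks -/

section Detection

variable {N : ℕ} (G : SimpleGraph (Fin N)) (S : Finset (Fin N)) (P₀ P₁ P₂ : Measure ℝ)

theorem ARL_eq_tsum {T : Obs G → WithTop ℕ}
    (hT : ∀ n : ℕ, MeasurableSet {ω | (n : ℕ∞) < T ω}) :
    ARL G P₀ T = ∑' n : ℕ, nullLaw G P₀ {ω | (n : ℕ∞) < T ω} := by
  have h := lintegral_mul_toENNReal_sub (nullLaw G P₀) hT (w := fun _ => 1) measurable_const 0
  simpa [ARL] using h

variable [IsProbabilityMeasure P₀] [IsProbabilityMeasure P₁] [IsProbabilityMeasure P₂]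

/-- Turns the worst-case delay into the hypothesis of `log_le_of_delay_le`. The conditioning is on
all edges, so weights that depend on the visible edges only are covered. -/
theorem sum_setLIntegral_le_EDD {T : Obs G → WithTop ℕ}
    (hT : ∀ n : ℕ, MeasurableSet {ω | (n : ℕ∞) < T ω}) (M k : ℕ) {w : Obs G → ℝ≥0∞}
    (hw : Measurable[past MeasurableSpace.pi k] w) :
    ∑ n ∈ Finset.Ico k M, ∫⁻ ω in {ω | (n : ℕ∞) < T ω}, w ω ∂(changeLaw G S P₀ P₁ P₂ (k + 1))
      ≤ EDD G S P₀ P₁ P₂ T * ∫⁻ ω, w ω ∂(changeLaw G S P₀ P₁ P₂ (k + 1)) := by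
  have hle : past MeasurableSpace.pi k ≤ (inferInstance : MeasurableSpace (Obs G)) :=
    past_le le_rfl k
  have hwm : Measurable w := hw.mono hle le_rfl
  have hprob : IsProbabilityMeasure (changeLaw G S P₀ P₁ P₂ (k + 1)) := by
    rw [changeLaw_eq]
    infer_instance
  have hE : essSup (condLExp (past MeasurableSpace.pi k) (changeLaw G S P₀ P₁ P₂ (k + 1))
        fun ω => ENat.toENNReal (T ω) - (k : ℝ≥0∞)) (changeLaw G S P₀ P₁ P₂ (k + 1))
      ≤ EDD G S P₀ P₁ P₂ T := by
    refine le_trans (le_of_eq ?_) (le_iSup₂ (f := fun (κ : ℕ) (_ : 1 ≤ κ) =>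
      essSup (condLExp (obsFiltration G Set.univ (κ - 1)) (changeLaw G S P₀ P₁ P₂ κ)
        (fun ω => ENat.toENNReal (T ω) + 1 - (κ : ℝ≥0∞))) (changeLaw G S P₀ P₁ P₂ κ))
      (k + 1) (Nat.le_add_left 1 k))
    have hfun : (fun ω => ENat.toENNReal (T ω) + 1 - ((k + 1 : ℕ) : ℝ≥0∞))
        = fun ω => ENat.toENNReal (T ω) - (k : ℝ≥0∞) :=
      funext fun ω => toENNReal_add_one_sub (T ω) k
    simp only [Nat.add_sub_cancel, obsFiltration_eq_past, edgeAlgebra_univ]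
    rw [hfun]
  calc _ = ∑ n ∈ Finset.range (M - k), ∫⁻ ω in {ω | ((k + n : ℕ) : ℕ∞) < T ω}, w ω
        ∂(changeLaw G S P₀ P₁ P₂ (k + 1)) := by
        rw [Finset.sum_Ico_eq_sum_range]
    _ ≤ _ := ENNReal.sum_le_tsum _
    _ = _ := (lintegral_mul_toENNReal_sub _ hT hwm k).symm
    _ ≤ _ := lintegral_mul_le_essSup_condLExp hle _ (measurable_toENNReal_sub hT k) hw
    _ ≤ _ := by gcongr

variable {P₀ P₁}

theorem exists_le_EDD (hcut : 0 < cut G S) (hne : P₁ ≠ P₀) (hKL : klDiv P₁ P₀ ≠ ∞) :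
    ∃ C : ℝ, ∀ γ : ℝ, 1 ≤ γ → ∀ T : Obs G → WithTop ℕ,
      IsStoppingTime (obsFiltration G Set.univ) T →
      (P₂ = P₀ ∨ IsStoppingTime (obsFiltration G (insideEdges G S)ᶜ) T) →
      ENNReal.ofReal γ ≤ ARL G P₀ T →
        ENNReal.ofReal (Real.log γ / ((cut G S : ℝ) * (klDiv P₁ P₀).toReal) - C)
          ≤ EDD G S P₀ P₁ P₂ T := by
  obtain ⟨hac, hint⟩ := klDiv_ne_top_iff.1 hKL
  set μ₀ := Measure.infinitePi fun _ : G.edgeSet => P₀ with hμ₀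
  set μ₁ := Measure.infinitePi (postLaw G S P₀ P₁ P₂) with hμ₁
  have hkl : 0 < (klDiv P₁ P₀).toReal :=
    ENNReal.toReal_pos (fun h => hne (klDiv_eq_zero_iff.1 h)) hKL
  have hIeq := integral_log_edgeRatio G S P₂ hac hint
  have hI : 0 < (cut G S : ℝ) * (klDiv P₁ P₀).toReal := by positivity
  set I := (cut G S : ℝ) * (klDiv P₁ P₀).toReal with hIdef
  set r := Real.log (1 - ∫⁻ x, NNReal.sqrt (edgeRatio G S P₀ P₁ x) ∂μ₀).toReal with hr
  -- Solving log γ ≤ I·d + 1 - r for the delay d.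
  refine ⟨(1 - r) / I, fun γ hγ T hT hT' harl => ?_⟩
  by_cases htop : EDD G S P₀ P₁ P₂ T = ∞
  · simp [htop]
  -- `U` is the set of visible edges: all of them if `P₂ = P₀`, otherwise those not inside `S`.
  obtain ⟨U, hU, hcutU, hTU⟩ : ∃ U, (P₂ = P₀ ∨ U ⊆ (insideEdges G S)ᶜ) ∧ cutEdges G S ⊆ U ∧
      IsStoppingTime (obsFiltration G U) T := by
    rcases hT' with h | h
    exacts [⟨Set.univ, Or.inl h, Set.subset_univ _, hT⟩,
      ⟨_, Or.inr subset_rfl, cutEdges_subset_compl_insideEdges G S, h⟩]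
  have hm := edgeAlgebra_le G U
  have hA := measurableSet_lt_of_isStoppingTime G hTU
  have hA' : ∀ n : ℕ, MeasurableSet {ω | (n : ℕ∞) < T ω} := fun n => past_le hm n _ (hA n)
  have hanti : Antitone fun n : ℕ => {ω | (n : ℕ∞) < T ω} := fun i j hij ω hω =>
    show (i : ℕ∞) < T ω from lt_of_le_of_lt (Nat.cast_le.2 hij) hω
  rw [ARL_eq_tsum G P₀ hA'] at harl
  have key := log_le_of_delay_le hm (measurable_edgeRatio G S P₀ P₁ hcutU)
    (infinitePi_postLaw_apply G S hac hU) (integrable_log_edgeRatio G S P₂ hac hint)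
    (by rw [hIeq]; exact hI) hA hanti (d := (EDD G S P₀ P₁ P₂ T).toReal) ENNReal.toReal_nonneg
    (fun M k w hw => ?_) hγ harl
  · rw [hIeq] at key
    refine ENNReal.ofReal_le_of_le_toReal ?_
    rw [← sub_div, div_le_iff₀ hI]
    linarith
  · rw [ENNReal.ofReal_toReal htop, ← changeLaw_eq]
    exact sum_setLIntegral_le_EDD G S P₀ P₁ P₂ hA' M k (hw.mono (past_mono_left hm k) le_rfl)

/-- The first time at which the CUSUM statistic of the observed networks reaches `B`. -/
noncomputable def cusumTime {E : Type*} (l : E → ℝ≥0) (B : ℝ≥0) (ω : ℕ → E) : ℕ∞ :=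
  ⨅ (n : ℕ) (_ : B ≤ cusum l n ω), (n : ℕ∞)

theorem setOf_lt_cusumTime {E : Type*} (l : E → ℝ≥0) (B : ℝ≥0) (n : ℕ) :
    {ω | (n : ℕ∞) < cusumTime l B ω} = below l B n := by
  ext ω
  constructor
  · intro h j hj
    by_contra hlt
    have hle : cusumTime l B ω ≤ j :=
      iInf₂_le (f := fun (i : ℕ) (_ : B ≤ cusum l i ω) => (i : ℕ∞)) j (not_lt.1 hlt)
    have hlt' : (n : ℕ∞) < j := lt_of_lt_of_le h hle
    exact hj.not_gt (Nat.cast_lt.1 hlt')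
  · intro h
    refine (ENat.add_one_le_iff (ENat.natCast_ne_top n)).1 (le_iInf₂ fun j hj => ?_)
    have : n < j := by
      by_contra hle
      exact (h j (not_lt.1 hle)).not_ge hj
    exact_mod_cast this

theorem isStoppingTime_cusumTime {U : Set (Sym2 (Fin N))} {l : (G.edgeSet → ℝ) → ℝ≥0}
    (hl : Measurable[edgeAlgebra G U] l) (B : ℝ≥0) :
    IsStoppingTime (obsFiltration G U) (cusumTime l B : Obs G → WithTop ℕ) := by
  intro n
  rw [obsFiltration_eq_past]
  convert (measurableSet_below hl B n).compl using 1
  rw [← setOf_lt_cusumTime]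
  ext ω
  exact (not_lt (b := cusumTime l B ω)).symm

theorem exists_EDD_le (hcut : 0 < cut G S) (hne : P₁ ≠ P₀) (hKL : klDiv P₁ P₀ ≠ ∞)
    (hsq : MemLp (llr P₁ P₀) 2 P₁) :
    ∃ C : ℝ, ∀ γ : ℝ, 1 ≤ γ → ∃ T : Obs G → WithTop ℕ,
      IsStoppingTime (obsFiltration G (insideEdges G S)ᶜ) T ∧
      ENNReal.ofReal γ ≤ ARL G P₀ T ∧
      EDD G S P₀ P₁ P₂ T ≤
        ENNReal.ofReal (Real.log γ / ((cut G S : ℝ) * (klDiv P₁ P₀).toReal) + C) := by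
  obtain ⟨hac, hint⟩ := klDiv_ne_top_iff.1 hKL
  set μ₀ := Measure.infinitePi fun _ : G.edgeSet => P₀ with hμ₀
  set μ₁ := Measure.infinitePi (postLaw G S P₀ P₁ P₂) with hμ₁
  have hkl : 0 < (klDiv P₁ P₀).toReal :=
    ENNReal.toReal_pos (fun h => hne (klDiv_eq_zero_iff.1 h)) hKL
  have hIeq := integral_log_edgeRatio G S P₂ hac hint
  have hI : 0 < (cut G S : ℝ) * (klDiv P₁ P₀).toReal := by positivity
  set I := (cut G S : ℝ) * (klDiv P₁ P₀).toReal with hIdef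
  have hsub := cutEdges_subset_compl_insideEdges G S
  have hm := edgeAlgebra_le G (insideEdges G S)ᶜ
  have hl := measurable_edgeRatio G S P₀ P₁ hsub
  have hlE : Measurable (edgeRatio G S P₀ P₁) := hl.mono hm le_rfl
  have hone : ∫⁻ x, edgeRatio G S P₀ P₁ x ∂μ₀ = 1 :=
    lintegral_density_eq_one (infinitePi_postLaw_apply G S (P₂ := P₂) hac (Or.inr subset_rfl))
  obtain ⟨C, hC⟩ := exists_sum_below_le (μ₀ := μ₀) hlE (edgeRatio_ne_zero G S P₂ hac)
    (memLp_log_edgeRatio G S P₂ hac hsq) (by rw [hIeq]; exact hI)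
  rw [hIeq] at hC
  refine ⟨(Real.log 2 + C) / I, fun γ hγ => ?_⟩
  -- The run length is at least B/2 = γ; the factor 2 only adds log 2 to the constant.
  set B : ℝ≥0 := 2 * γ.toNNReal with hB
  have hBr : (B : ℝ) = 2 * γ := by simp [hB, Real.coe_toNNReal γ (by linarith)]
  have hB1 : 1 < B := by
    rw [← NNReal.coe_lt_coe, hBr]
    push_cast
    linarith
  have hlogB : Real.log B = Real.log 2 + Real.log γ := by
    rw [hBr, Real.log_mul two_ne_zero (by positivity)]
  set T : Obs G → WithTop ℕ := cusumTime (edgeRatio G S P₀ P₁) B with hTdef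
  have hTn : ∀ n : ℕ, {ω | (n : ℕ∞) < T ω} = below (edgeRatio G S P₀ P₁) B n :=
    setOf_lt_cusumTime _ B
  have hA : ∀ n : ℕ, MeasurableSet {ω | (n : ℕ∞) < T ω} := fun n => by
    rw [hTn]
    exact past_le le_rfl n _ (measurableSet_below hlE B n)
  refine ⟨T, isStoppingTime_cusumTime G hl B, ?_, ?_⟩
  · rw [ARL_eq_tsum G P₀ hA]
    simp_rw [hTn]
    have h := le_two_mul_tsum_below hlE hone B
    rw [hB, ENNReal.coe_mul] at h
    exact (ENNReal.mul_le_mul_iff_right two_ne_zero ENNReal.ofNat_ne_top).1 h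
  · refine iSup₂_le fun κ hκ => ?_
    obtain ⟨k, rfl⟩ : ∃ k, κ = k + 1 := ⟨κ - 1, by omega⟩
    have hfun : (fun ω => ENat.toENNReal (T ω) + 1 - ((k + 1 : ℕ) : ℝ≥0∞))
        = fun ω => ENat.toENNReal (T ω) - (k : ℝ≥0∞) :=
      funext fun ω => toENNReal_add_one_sub (T ω) k
    simp only [Nat.add_sub_cancel, obsFiltration_eq_past, edgeAlgebra_univ, changeLaw_eq]
    rw [hfun]
    refine essSup_condLExp_le (past_le le_rfl k) _ fun A hA' => ?_
    have hAm := past_le le_rfl k _ hA'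
    have hmul : ∫⁻ ω in A, (ENat.toENNReal (T ω) - (k : ℝ≥0∞)) ∂(changeSeq μ₀ μ₁ k)
        = ∑' n, changeSeq μ₀ μ₁ k (A ∩ below (edgeRatio G S P₀ P₁) B (k + n)) := by
      have h := lintegral_mul_toENNReal_sub ((changeSeq μ₀ μ₁ k).restrict A) hA
        (w := fun _ => 1) measurable_const k
      simp only [one_mul, setLIntegral_one] at h
      rw [h]
      refine tsum_congr fun n => ?_
      rw [Measure.restrict_apply (hA _), Set.inter_comm, hTn]
    have hfinal : ENNReal.ofReal I * ∫⁻ ω in A, (ENat.toENNReal (T ω) - (k : ℝ≥0∞))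
        ∂(changeSeq μ₀ μ₁ k) ≤ ENNReal.ofReal (Real.log B + C) * changeSeq μ₀ μ₁ k A := by
      rw [hmul, ENNReal.tsum_eq_iSup_nat, ENNReal.mul_iSup]
      refine iSup_le fun M => ?_
      have h := hC B hB1 k (k + M) A hA'
      rwa [Finset.sum_Ico_eq_sum_range, Nat.add_sub_cancel_left] at h
    have hdiv : Real.log γ / I + (Real.log 2 + C) / I = (Real.log B + C) / I := by
      rw [hlogB]
      ring
    rw [hdiv, ENNReal.ofReal_div_of_pos hI, ENNReal.div_eq_inv_mul, mul_assoc,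
      ← ENNReal.div_eq_inv_mul,
      ENNReal.le_div_iff_mul_le (Or.inl (ENNReal.ofReal_pos.2 hI).ne')
        (Or.inl ENNReal.ofReal_ne_top), mul_comm]
    exact hfinal

end Detection

end SimNet

theorem proposition1 {N : ℕ} (G : SimpleGraph (Fin N)) (S : Finset (Fin N))
    (P₀ P₁ P₂ : Measure ℝ)
    [IsProbabilityMeasure P₀] [IsProbabilityMeasure P₁] [IsProbabilityMeasure P₂]
    (hcut : 0 < SimNet.cut G S) (hne : P₁ ≠ P₀) (hKL : klDiv P₁ P₀ ≠ ∞) :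
    (MemLp (llr P₁ P₀) 2 P₁ →
      ∃ C : ℝ, ∀ γ : ℝ, 1 ≤ γ →
        ∃ T : SimNet.Obs G → WithTop ℕ,
          IsStoppingTime (SimNet.obsFiltration G (SimNet.insideEdges G S)ᶜ) T ∧
          ENNReal.ofReal γ ≤ SimNet.ARL G P₀ T ∧
          SimNet.EDD G S P₀ P₁ P₂ T ≤
            ENNReal.ofReal
              (Real.log γ / ((SimNet.cut G S : ℝ) * (klDiv P₁ P₀).toReal) + C)) ∧
    (∃ C : ℝ, ∀ γ : ℝ, 1 ≤ γ →
      ∀ T : SimNet.Obs G → WithTop ℕ,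
        IsStoppingTime (SimNet.obsFiltration G Set.univ) T →
        (P₂ = P₀ ∨ IsStoppingTime (SimNet.obsFiltration G (SimNet.insideEdges G S)ᶜ) T) →
        ENNReal.ofReal γ ≤ SimNet.ARL G P₀ T →
          ENNReal.ofReal
              (Real.log γ / ((SimNet.cut G S : ℝ) * (klDiv P₁ P₀).toReal) - C) ≤
            SimNet.EDD G S P₀ P₁ P₂ T) := by
  exact ⟨SimNet.exists_EDD_le G S P₂ hcut hne hKL, SimNet.exists_le_EDD G S P₂ hcut hne hKL⟩
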